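/- Let $A\in\mathbb R^{n\times n}$, $B\in\mathbb R^{n\times q}$, $C\in\mathbb R^{p\times n}$, $D\in\mathbb R^{p\times q}$ with $R:=DD^\top>0$ and $BD^\top=0$, and put $Q:=BB^\top$. For a symmetric $P\ge 0$ let $P^+$ be its pseudo inverse, $\det^+P$ the product of its nonzero eigenvalues, and $\Pi_P$ the orthogonal projection onto $\mathrm{Im}(P)$. For $\theta\in\mathbb R$ put $\tilde P_{\theta}:=(P^+-\theta\,\Pi_P)^+$ and, for $\lambda>0$, $$\gamma(P,\lambda):=\tfrac12\left\{\ln\det{}^+P-\ln\det{}^+\tilde P_{\lambda^{-1}}+\mathrm{tr}(P^+\tilde P_{\lambda^{-1}})-\mathrm{rank}(P)\right\}.$$ For $c>0$ and $P\ne0$ let $\theta_c(P):=\lambda^{-1}$, where $\lambda>\sigma_{max}(P)$ is the unique solution of $\gamma(P,\lambda)=c$; for $P=0$ the value of $\theta_c(P)$ is immaterial. Define the standard Riccati map $$r(P):=APA^\top-APC^\top(CPC^\top+R)^{-1}CPA^\top+Q$$ and the low-rank robust Riccati map $r_c(P):=r\big(\tilde P_{\theta_c(P)}\big)$. Assume that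 $(A,B)$ is stabilizable (in discrete time) and that the reachable subsystem, i.e. the restriction of $(A,C)$ to the reachable subspace $\sum_{k\ge0}\mathrm{Im}(A^kB)$, is observable. Then the standard iteration $\bar P_{t+1}=r(\bar P_t)$ converges to one and the same limit $\bar P_\infty$ for every $\bar P_0\ge0$, and there exists $c_{MAX}>0$ such that the following holds for every $0<c<c_{MAX}$. Let $U\in\mathbb R^{n\times l}$ be a matrix whose columns form an orthonormal basis of $\mathrm{Im}(\bar P_\infty)$, and put $A_R:=U^\top AU$, $Q_R:=U^\top QU$, $C_R:=CU$. Then the reduced map $$r_c^R(X):=A_R\big(X^{-1}-\theta_c(X)I+C_R^\top R^{-1}C_R\big)^{-1}A_R^\top+Q_R$$ has exactly one positive definite fixed point $P_\infty^R$, and for every initial condition $P_0\ge0$ the sequence $P_{t+1}=r_c(P_t)$ converges to $P_\infty:=UP_\infty^RU^\top$. -/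

import Mathlib

open Filter Topology Matrix

noncomputable section

namespace LowRankRiccati

/-- `X` satisfies the four Penrose equations for the real matrix `M`. -/
structure IsPseudoInverse {m n : ℕ} (M : Matrix (Fin m) (Fin n) ℝ)
    (X : Matrix (Fin n) (Fin m) ℝ) : Prop where
  mul_mul_self : M * X * M = M
  mul_mul_inv : X * M * X = X
  symm_left : (M * X)ᵀ = M * X
  symm_right : (X * M)ᵀ = X * M

/-- The Penrose equations have at most one solution. -/
theorem IsPseudoInverse.unique {m n : ℕ} {M : Matrix (Fin m) (Fin n) ℝ}
    {X Y : Matrix (Fin n) (Fin m) ℝ} (hX : IsPseudoInverse M X) (hY : IsPseudoInverse M Y) :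
    X = Y := by
  have h1 : M * X = M * Y := by
    calc M * X = (M * X)ᵀ := hX.symm_left.symm
      _ = ((M * Y) * (M * X))ᵀ := by rw [← Matrix.mul_assoc, hY.mul_mul_self]
      _ = (M * X)ᵀ * (M * Y)ᵀ := Matrix.transpose_mul _ _
      _ = M * X * (M * Y) := by rw [hX.symm_left, hY.symm_left]
      _ = M * Y := by rw [← Matrix.mul_assoc, hX.mul_mul_self]
  have h2 : X * M = Y * M := by
    calc X * M = (X * M)ᵀ := hX.symm_right.symm
      _ = ((X * M) * (Y * M))ᵀ := by
          rw [Matrix.mul_assoc X M, ← Matrix.mul_assoc M Y M, hY.mul_mul_self]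
      _ = (Y * M)ᵀ * (X * M)ᵀ := Matrix.transpose_mul _ _
      _ = Y * M * (X * M) := by rw [hX.symm_right, hY.symm_right]
      _ = Y * M := by rw [Matrix.mul_assoc, ← Matrix.mul_assoc M X M, hX.mul_mul_self]
  calc X = X * M * X := hX.mul_mul_inv.symm
    _ = Y * M * Y := by rw [h2, Matrix.mul_assoc, h1, ← Matrix.mul_assoc]
    _ = Y := hY.mul_mul_inv

/-- Every real symmetric matrix has a pseudo inverse. -/
theorem exists_isPseudoInverse {n : ℕ} {M : Matrix (Fin n) (Fin n) ℝ} (hM : M.IsHermitian) :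
    ∃ X, IsPseudoInverse M X := by
  obtain ⟨U, v, hUU, rfl⟩ : ∃ (U : Matrix (Fin n) (Fin n) ℝ) (v : Fin n → ℝ),
      Uᵀ * U = 1 ∧ M = U * diagonal v * Uᵀ := by
    refine ⟨hM.eigenvectorUnitary, hM.eigenvalues, ?_, ?_⟩
    · have h := Unitary.coe_star_mul_self hM.eigenvectorUnitary
      rwa [Matrix.star_eq_conjTranspose, Matrix.conjTranspose_eq_transpose_of_trivial] at h
    · have h := hM.spectral_theorem
      rw [Unitary.conjStarAlgAut_apply, Matrix.star_eq_conjTranspose,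
        Matrix.conjTranspose_eq_transpose_of_trivial] at h
      exact h
  have key : ∀ d e : Fin n → ℝ,
      U * diagonal d * Uᵀ * (U * diagonal e * Uᵀ) = U * diagonal (fun i => d i * e i) * Uᵀ := by
    intro d e
    calc U * diagonal d * Uᵀ * (U * diagonal e * Uᵀ)
        = U * diagonal d * (Uᵀ * U) * diagonal e * Uᵀ := by simp only [Matrix.mul_assoc]
      _ = U * (diagonal d * diagonal e) * Uᵀ := by
          rw [hUU, Matrix.mul_one]; simp only [Matrix.mul_assoc]
      _ = U * diagonal (fun i => d i * e i) * Uᵀ := by rw [Matrix.diagonal_mul_diagonal]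
  have ht : ∀ d : Fin n → ℝ, (U * diagonal d * Uᵀ)ᵀ = U * diagonal d * Uᵀ := by
    intro d
    simp [Matrix.transpose_mul, Matrix.mul_assoc]
  refine ⟨U * diagonal (fun i => (v i)⁻¹) * Uᵀ, ?_, ?_, ?_, ?_⟩
  · rw [key, key]
    simp only [mul_inv_mul_cancel]
  · rw [key, key]
    congr 3
    funext i
    by_cases hi : v i = 0 <;> simp [hi]
  · rw [key, ht]
  · rw [key, ht]

open Classical in
/-- The Moore-Penrose pseudo inverse `M⁺`. -/
def pinv {m n : ℕ} (M : Matrix (Fin m) (Fin n) ℝ) : Matrix (Fin n) (Fin m) ℝ :=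
  if h : ∃ X, IsPseudoInverse M X then h.choose else 0

/-- The pseudo inverse of a symmetric matrix satisfies the Penrose equations. -/
theorem isPseudoInverse_pinv {n : ℕ} {M : Matrix (Fin n) (Fin n) ℝ} (hM : M.IsHermitian) :
    IsPseudoInverse M (pinv M) := by
  have h := exists_isPseudoInverse hM
  rw [pinv, dif_pos h]
  exact h.choose_spec

/-- The pseudo determinant `det⁺ M` of a symmetric matrix: the product of its nonzero eigenvalues,
counted with multiplicity (`1` for the zero matrix). -/
def pdet {n : ℕ} (M : Matrix (Fin n) (Fin n) ℝ) : ℝ :=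
  (M.charpoly.roots.filter (fun x => x ≠ 0)).prod

/-- The matrix of the orthogonal projection of `ℝⁿ` onto the image of `M`, that is `Hᵀ H` for any
`H` such that the columns of `Hᵀ` form an orthonormal basis of the image of `M`. -/
def imageProj {n : ℕ} (M : Matrix (Fin n) (Fin n) ℝ) : Matrix (Fin n) (Fin n) ℝ :=
  (Matrix.toEuclideanCLM (n := Fin n) (𝕜 := ℝ)).symm
    (LinearMap.range (Matrix.toEuclideanLin M)).starProjection

/-- The distorted covariance `(P⁺ - θ Hᵀ H)⁺` with risk sensitivity parameter `θ`. -/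
def distort {n : ℕ} (P : Matrix (Fin n) (Fin n) ℝ) (θ : ℝ) : Matrix (Fin n) (Fin n) ℝ :=
  pinv (pinv P - θ • imageProj P)

/-- `γ(P, lam) = ½ (ln det⁺ P - ln det⁺ P̃ + tr (P⁺ P̃) - rank P)` with `P̃ = (P⁺ - lam⁻¹ Hᵀ H)⁺`:
the relative entropy between the centred Gaussians with covariances `P̃` and `P`. -/
def gam {n : ℕ} (P : Matrix (Fin n) (Fin n) ℝ) (lam : ℝ) : ℝ :=
  (1 / 2) * (Real.log (pdet P) - Real.log (pdet (distort P lam⁻¹))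
    + (Matrix.trace (pinv P * distort P lam⁻¹) - (P.rank : ℝ)))

/-- `lam` is the Lagrange multiplier of `P` at tolerance `c`: `lam > σ_max(P)`, `lam > 0` and
`γ(P, lam) = c`. -/
def IsMultiplier {n : ℕ} (c : ℝ) (P : Matrix (Fin n) (Fin n) ℝ) (lam : ℝ) : Prop :=
  0 < lam ∧ (∀ σ ∈ spectrum ℝ P, σ < lam) ∧ gam P lam = c

open Classical in
/-- The risk sensitivity parameter `θ = lam⁻¹`, with `lam` the Lagrange multiplier of `P` at
tolerance `c`. For `c > 0` a positive semidefinite `P ≠ 0` has exactly one multiplier; `P = 0` has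
none, but there the value of `θ` is irrelevant because `distort 0 θ = 0` for every `θ`. -/
def riskParam {n : ℕ} (c : ℝ) (P : Matrix (Fin n) (Fin n) ℝ) : ℝ :=
  if h : ∃ lam, IsMultiplier c P lam then h.choose⁻¹ else 0

/-- The standard Riccati map
`P ↦ A P Aᵀ - A P Cᵀ (C P Cᵀ + R)⁻¹ C P Aᵀ + Q`, with `R = D Dᵀ` and `Q = B Bᵀ`. -/
def riccati {n p q : ℕ} (A : Matrix (Fin n) (Fin n) ℝ) (B : Matrix (Fin n) (Fin q) ℝ)
    (C : Matrix (Fin p) (Fin n) ℝ) (D : Matrix (Fin p) (Fin q) ℝ)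
    (P : Matrix (Fin n) (Fin n) ℝ) : Matrix (Fin n) (Fin n) ℝ :=
  A * P * Aᵀ - A * P * Cᵀ * (C * P * Cᵀ + D * Dᵀ)⁻¹ * C * P * Aᵀ + B * Bᵀ

/-- The low-rank robust Riccati map `r_c`: the standard Riccati map applied to the distorted
covariance `P̃` of `P` at tolerance `c`. -/
def robustRiccati {n p q : ℕ} (A : Matrix (Fin n) (Fin n) ℝ) (B : Matrix (Fin n) (Fin q) ℝ)
    (C : Matrix (Fin p) (Fin n) ℝ) (D : Matrix (Fin p) (Fin q) ℝ) (c : ℝ)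
    (P : Matrix (Fin n) (Fin n) ℝ) : Matrix (Fin n) (Fin n) ℝ :=
  riccati A B C D (distort P (riskParam c P))

/-- The reduced robust Riccati map on positive definite matrices,
`r_c^R(X) = A_R (X⁻¹ - θ I + C_Rᵀ R⁻¹ C_R)⁻¹ A_Rᵀ + Q_R`, where `A_R = Uᵀ A U`,
`Q_R = Uᵀ B Bᵀ U`, `C_R = C U`, `R = D Dᵀ` and `θ` is the risk sensitivity parameter of `X`. -/
def reducedRobustRiccati {n p q l : ℕ} (A : Matrix (Fin n) (Fin n) ℝ)
    (B : Matrix (Fin n) (Fin q) ℝ) (C : Matrix (Fin p) (Fin n) ℝ) (D : Matrix (Fin p) (Fin q) ℝ)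
    (U : Matrix (Fin n) (Fin l) ℝ) (c : ℝ) (X : Matrix (Fin l) (Fin l) ℝ) :
    Matrix (Fin l) (Fin l) ℝ :=
  (Uᵀ * A * U) * (X⁻¹ - riskParam c X • (1 : Matrix (Fin l) (Fin l) ℝ)
    + (C * U)ᵀ * (D * Dᵀ)⁻¹ * (C * U))⁻¹ * (Uᵀ * A * U)ᵀ + Uᵀ * (B * Bᵀ) * U

/-- All complex eigenvalues of the real matrix `M` lie in the open unit disc. -/
def IsSchurStable {n : ℕ} (M : Matrix (Fin n) (Fin n) ℝ) : Prop :=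
  ∀ μ ∈ spectrum ℂ (M.map (fun x : ℝ => (x : ℂ))), ‖μ‖ < 1

/-- Stabilizability of `(A, B)` in discrete time. -/
def Stabilizable {n q : ℕ} (A : Matrix (Fin n) (Fin n) ℝ) (B : Matrix (Fin n) (Fin q) ℝ) : Prop :=
  ∃ K : Matrix (Fin q) (Fin n) ℝ, IsSchurStable (A + B * K)

/-- The reachable subspace of `(A, B)`: the sum of the images of `B, A B, A² B, …`. -/
def reachableSubspace {n q : ℕ} (A : Matrix (Fin n) (Fin n) ℝ) (B : Matrix (Fin n) (Fin q) ℝ) :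
    Submodule ℝ (Fin n → ℝ) :=
  ⨆ k : ℕ, LinearMap.range (A ^ k * B).mulVecLin

/-- The reachable subsystem, i.e. the restriction of `A` and `C` to the (`A`-invariant) reachable
subspace, is observable: a reachable state with identically zero free output is zero. -/
def ReachableSubsystemObservable {n p q : ℕ} (A : Matrix (Fin n) (Fin n) ℝ)
    (B : Matrix (Fin n) (Fin q) ℝ) (C : Matrix (Fin p) (Fin n) ℝ) : Prop :=
  ∀ x ∈ reachableSubspace A B, (∀ k : ℕ, (C * A ^ k) *ᵥ x = 0) → x = 0

end LowRankRiccati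

end

/-!
The argument compares everything in the Loewner order, expressed through quadratic forms.

*Standard iteration.* Completion of squares shows that `r(P)` is the least value, over all gains
`K`, of `(A - K C) P (A - K C)ᵀ + K R Kᵀ + Q`, attained at the Kalman gain
(`gainStep_eq_riccati_add`). Hence `r` is monotone, and every gain gives an upper bound.
Observability of the reachable subsystem provides time-varying gains whose error transition matrix
vanishes on the reachable subspace (`exists_deadbeat`), so the iteration from `0` is bounded; being
increasing, it converges to a fixed point `P̄` (`exists_riccati_fixedPoint`). Stabilizability makes
the closed loop `F = A - K̄ C` of `P̄` stable, with a form `W ≥ 1` such that `F W Fᵀ ≤ ρ W`, `ρ < 1`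
(`exists_closedLoop_lyapunov`). Every other orbit is squeezed between the iteration from `0` and
`P̄ + ρᵗ a W`.

*Distortion.* For positive semidefinite `P` the multiplier condition only involves `1 - θ P`
(`isMultiplier_iff`), hence makes no distinction between singular and regular `P`, and
`P̃ = P (1 - θ P)⁻¹`. For small `c` this gives `P ≤ P̃ ≤ κ P` with `κ` close to `1`
(`riskParam_bounds`). Concavity of `log det` shows that the parameter `θ` is a Lipschitz function of
`P` with a small constant as long as `P` stays bounded and away from `0`; by the resolvent identity
`P ↦ P̃ - P` is then Lipschitz with a small constant (`exists_distort_lipschitz`).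

*Robust iteration.* From `r(P) ≤ r_c(P) ≤ r(κ P)` every orbit of `r_c` enters a small neighbourhood
of `P̄` (`eventually_abs_qf_sub_le`). There `r_c` is a contraction for the gauge
`inf {ε | -ε W ≤ Δ ≤ ε W}` (`exists_contraction`), because the increments of `r` are bounded by
closed loops close to `F`. So all orbits have a common limit, which is a fixed point
(`exists_robust_attractor`). The image of `P̄` is invariant, and on it `r_c` is conjugate to the
reduced map by the matrix inversion lemma (`robustRiccati_conj`); uniqueness of the positive
definite fixed point follows from global attraction.
-/

namespace LowRankRiccati

open scoped Matrix.Norms.Operator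

/-! ### Quadratic forms -/

/-- The quadratic form `x ↦ xᵀ M x`. The Loewner order `M ≤ N` is expressed as
`∀ x, qf M x ≤ qf N x`, symmetry being recorded separately. -/
def qf {n : ℕ} (M : Matrix (Fin n) (Fin n) ℝ) (x : Fin n → ℝ) : ℝ := x ⬝ᵥ M *ᵥ x

section Forms

variable {m n : ℕ}

theorem qf_add (M N : Matrix (Fin n) (Fin n) ℝ) (x : Fin n → ℝ) :
    qf (M + N) x = qf M x + qf N x := by
  simp [qf, Matrix.add_mulVec]

theorem qf_sub (M N : Matrix (Fin n) (Fin n) ℝ) (x : Fin n → ℝ) :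
    qf (M - N) x = qf M x - qf N x := by
  simp [qf, Matrix.sub_mulVec]

theorem qf_smul (a : ℝ) (M : Matrix (Fin n) (Fin n) ℝ) (x : Fin n → ℝ) :
    qf (a • M) x = a * qf M x := by
  simp [qf, Matrix.smul_mulVec]

theorem qf_zero (x : Fin n → ℝ) : qf (0 : Matrix (Fin n) (Fin n) ℝ) x = 0 := by
  simp [qf]

theorem qf_one (x : Fin n → ℝ) : qf (1 : Matrix (Fin n) (Fin n) ℝ) x = x ⬝ᵥ x := by
  simp [qf]

theorem qf_sum {ι : Type*} (s : Finset ι) (f : ι → Matrix (Fin n) (Fin n) ℝ) (x : Fin n → ℝ) :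
    qf (∑ i ∈ s, f i) x = ∑ i ∈ s, qf (f i) x := by
  simp [qf, Matrix.sum_mulVec, dotProduct_sum]

theorem qf_conj (A : Matrix (Fin n) (Fin m) ℝ) (M : Matrix (Fin m) (Fin m) ℝ) (x : Fin n → ℝ) :
    qf (A * M * Aᵀ) x = qf M (Aᵀ *ᵥ x) := by
  rw [qf, qf, Matrix.mul_assoc, ← Matrix.mulVec_mulVec, ← Matrix.mulVec_mulVec,
    Matrix.dotProduct_mulVec, ← Matrix.mulVec_transpose]

theorem qf_mul_transpose (A : Matrix (Fin n) (Fin m) ℝ) (x : Fin n → ℝ) :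
    qf (A * Aᵀ) x = (Aᵀ *ᵥ x) ⬝ᵥ (Aᵀ *ᵥ x) := by
  have h := qf_conj A 1 x
  rwa [Matrix.mul_one, qf_one] at h

theorem dot_self_nonneg (x : Fin n → ℝ) : 0 ≤ x ⬝ᵥ x :=
  Finset.sum_nonneg fun i _ => mul_self_nonneg (x i)

theorem posSemidef_iff_qf {M : Matrix (Fin n) (Fin n) ℝ} :
    M.PosSemidef ↔ Mᵀ = M ∧ ∀ x, 0 ≤ qf M x := by
  rw [Matrix.posSemidef_iff_dotProduct_mulVec, Matrix.IsHermitian,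
    Matrix.conjTranspose_eq_transpose_of_trivial]
  simp [qf]

theorem posDef_iff_qf {M : Matrix (Fin n) (Fin n) ℝ} :
    M.PosDef ↔ Mᵀ = M ∧ ∀ x, x ≠ 0 → 0 < qf M x := by
  rw [Matrix.posDef_iff_dotProduct_mulVec, Matrix.IsHermitian,
    Matrix.conjTranspose_eq_transpose_of_trivial]
  simp [qf]

theorem transpose_of_posSemidef {M : Matrix (Fin n) (Fin n) ℝ} (h : M.PosSemidef) : Mᵀ = M :=
  (posSemidef_iff_qf.1 h).1

theorem qf_nonneg {M : Matrix (Fin n) (Fin n) ℝ} (h : M.PosSemidef) (x : Fin n → ℝ) :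
    0 ≤ qf M x :=
  (posSemidef_iff_qf.1 h).2 x

theorem mulVec_eq_zero_of_qf {M : Matrix (Fin n) (Fin n) ℝ} (h : M.PosSemidef) {x : Fin n → ℝ}
    (hx : qf M x = 0) : M *ᵥ x = 0 := by
  have := (h.dotProduct_mulVec_zero_iff x).1
  simp only [star_trivial] at this
  exact this hx

theorem qf_add_vec {M : Matrix (Fin n) (Fin n) ℝ} (h : Mᵀ = M) (x y : Fin n → ℝ) :
    qf M (x + y) = qf M x + 2 * (x ⬝ᵥ M *ᵥ y) + qf M y := by
  have : y ⬝ᵥ M *ᵥ x = x ⬝ᵥ M *ᵥ y := by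
    conv_lhs => rw [Matrix.dotProduct_mulVec, ← Matrix.mulVec_transpose, h, dotProduct_comm]
  simp only [qf, Matrix.mulVec_add, add_dotProduct, dotProduct_add, this]
  ring

theorem qf_smul_vec (M : Matrix (Fin n) (Fin n) ℝ) (a : ℝ) (x : Fin n → ℝ) :
    qf M (a • x) = a ^ 2 * qf M x := by
  simp only [qf, Matrix.mulVec_smul, smul_dotProduct, dotProduct_smul, smul_eq_mul]
  ring

theorem qf_single (M : Matrix (Fin n) (Fin n) ℝ) (i : Fin n) : qf M (Pi.single i 1) = M i i := by
  simp [qf]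

theorem entry_eq_qf {M : Matrix (Fin n) (Fin n) ℝ} (h : Mᵀ = M) (i j : Fin n) :
    M i j = (qf M (Pi.single i 1 + Pi.single j 1) - qf M (Pi.single i 1) - qf M (Pi.single j 1))
      / 2 := by
  rw [qf_add_vec h]
  have : (Pi.single i 1 : Fin n → ℝ) ⬝ᵥ M *ᵥ (Pi.single j 1 : Fin n → ℝ) = M i j := by simp
  rw [this]
  ring

theorem continuous_qf (x : Fin n → ℝ) :
    Continuous fun M : Matrix (Fin n) (Fin n) ℝ => qf M x := by
  unfold qf
  fun_prop

/-- Polarization: symmetric matrices converge as soon as their quadratic forms do. -/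
theorem tendsto_of_tendsto_qf {ι : Type*} {l : Filter ι} {M : ι → Matrix (Fin n) (Fin n) ℝ}
    {L : Matrix (Fin n) (Fin n) ℝ} (hM : ∀ t, (M t)ᵀ = M t) (hL : Lᵀ = L)
    (h : ∀ x, Tendsto (fun t => qf (M t) x) l (𝓝 (qf L x))) : Tendsto M l (𝓝 L) := by
  refine tendsto_pi_nhds.2 fun i => tendsto_pi_nhds.2 fun j => ?_
  rw [entry_eq_qf hL]
  simp_rw [entry_eq_qf (hM _)]
  exact (((h _).sub (h _)).sub (h _)).div_const 2

/-- A sequence of symmetric matrices that increases and is bounded above in the Loewner order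
converges. -/
theorem exists_tendsto_of_monotone {M : ℕ → Matrix (Fin n) (Fin n) ℝ} (hM : ∀ t, (M t)ᵀ = M t)
    (hmono : ∀ x, Monotone fun t => qf (M t) x) (W : Matrix (Fin n) (Fin n) ℝ)
    (hb : ∀ t x, qf (M t) x ≤ qf W x) : ∃ L, Lᵀ = L ∧ Tendsto M atTop (𝓝 L) := by
  have hlim : ∀ x, ∃ a, Tendsto (fun t => qf (M t) x) atTop (𝓝 a) := fun x =>
    ⟨_, tendsto_atTop_ciSup (hmono x) ⟨qf W x, by rintro _ ⟨t, rfl⟩; exact hb t x⟩⟩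
  choose a ha using hlim
  have hent : ∀ i j, ∃ b, Tendsto (fun t => M t i j) atTop (𝓝 b) := fun i j => by
    simp_rw [entry_eq_qf (hM _)]
    exact ⟨_, (((ha _).sub (ha _)).sub (ha _)).div_const 2⟩
  choose L hL using hent
  have hL' : Tendsto M atTop (𝓝 (Matrix.of L)) :=
    tendsto_pi_nhds.2 fun i => tendsto_pi_nhds.2 fun j => hL i j
  refine ⟨Matrix.of L, ?_, hL'⟩
  have h2 : Tendsto (fun t => (M t)ᵀ) atTop (𝓝 (Matrix.of L)ᵀ) :=
    (continuous_id.matrix_transpose.tendsto _).comp hL'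
  simp_rw [hM] at h2
  exact tendsto_nhds_unique h2 hL'

theorem abs_qf_le_norm {M : Matrix (Fin n) (Fin n) ℝ} (h : Mᵀ = M) (x : Fin n → ℝ) :
    |qf M x| ≤ ‖M‖ * (x ⬝ᵥ x) := by
  have hrow : ∀ i, ∑ j, |M i j| ≤ ‖M‖ := fun i => by
    rw [Matrix.linfty_opNorm_def]
    have : (∑ j, ‖M i j‖₊) ≤ Finset.univ.sup fun i => ∑ j, ‖M i j‖₊ :=
      Finset.le_sup (f := fun i => ∑ j, ‖M i j‖₊) (Finset.mem_univ i)
    have h2 := NNReal.coe_le_coe.2 this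
    simpa using h2
  have hsym : ∀ i j, M j i = M i j := fun i j => congrFun (congrFun h i) j
  have h1 : |qf M x| ≤ ∑ i, ∑ j, (|M i j| * (x i ^ 2) / 2 + |M i j| * (x j ^ 2) / 2) := by
    have : qf M x = ∑ i, ∑ j, x i * (M i j * x j) := by
      simp [qf, dotProduct, Matrix.mulVec, Finset.mul_sum]
    rw [this]
    refine (Finset.abs_sum_le_sum_abs _ _).trans (Finset.sum_le_sum fun i _ => ?_)
    refine (Finset.abs_sum_le_sum_abs _ _).trans (Finset.sum_le_sum fun j _ => ?_)
    rw [abs_mul, abs_mul]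
    have := two_mul_le_add_sq |x i| |x j|
    rw [sq_abs, sq_abs] at this
    nlinarith [abs_nonneg (M i j)]
  have h2 : ∑ i, ∑ j, (|M i j| * (x i ^ 2) / 2 + |M i j| * (x j ^ 2) / 2)
      = ∑ i, (∑ j, |M i j|) * x i ^ 2 := by
    simp_rw [Finset.sum_add_distrib]
    conv_lhs => arg 2; rw [Finset.sum_comm]
    rw [← Finset.sum_add_distrib]
    refine Finset.sum_congr rfl fun i _ => ?_
    rw [← Finset.sum_add_distrib, Finset.sum_mul]
    refine Finset.sum_congr rfl fun j _ => ?_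
    rw [hsym i j]
    ring
  rw [h2] at h1
  refine h1.trans ?_
  rw [dotProduct, Finset.mul_sum]
  refine Finset.sum_le_sum fun i _ => ?_
  rw [← sq]
  exact mul_le_mul_of_nonneg_right (hrow i) (sq_nonneg _)

theorem qf_le_norm {M : Matrix (Fin n) (Fin n) ℝ} (h : Mᵀ = M) (x : Fin n → ℝ) :
    qf M x ≤ ‖M‖ * (x ⬝ᵥ x) :=
  (le_abs_self _).trans (abs_qf_le_norm h x)

theorem norm_le_of_abs_qf_le {M : Matrix (Fin n) (Fin n) ℝ} (h : Mᵀ = M) {ε : ℝ} (hε : 0 ≤ ε)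
    (hM : ∀ x, |qf M x| ≤ ε * (x ⬝ᵥ x)) : ‖M‖ ≤ n * ε := by
  have hent : ∀ i j, |M i j| ≤ ε := fun i j => by
    -- the polarization identity `4 M i j = qf (e i + e j) - qf (e i - e j)`
    have h1 := hM (Pi.single i 1 + Pi.single j 1)
    have h2 := hM (Pi.single i 1 + (-1 : ℝ) • Pi.single j 1)
    have hij : (Pi.single i 1 : Fin n → ℝ) ⬝ᵥ M *ᵥ (Pi.single j 1 : Fin n → ℝ) = M i j := by simp
    have hd : ∀ k l : Fin n, (Pi.single k 1 : Fin n → ℝ) ⬝ᵥ (Pi.single l 1 : Fin n → ℝ)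
        = if k = l then 1 else 0 := fun k l => by
      simp [Pi.single_apply, eq_comm]
    rw [qf_add_vec h, hij] at h1
    rw [qf_add_vec h, qf_smul_vec, Matrix.mulVec_smul, dotProduct_smul, hij] at h2
    simp only [add_dotProduct, dotProduct_add, smul_dotProduct, dotProduct_smul, hd,
      smul_eq_mul, if_true, eq_comm (a := j) (b := i)] at h1 h2
    rw [abs_le] at h1 h2 ⊢
    split_ifs at h1 h2 <;> constructor <;> nlinarith
  rw [Matrix.linfty_opNorm_def]
  have : (Finset.univ.sup fun i => ∑ j, ‖M i j‖₊) ≤ n * ε.toNNReal := by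
    refine Finset.sup_le fun i _ => ?_
    calc ∑ j, ‖M i j‖₊ ≤ ∑ _j : Fin n, ε.toNNReal := by
          refine Finset.sum_le_sum fun j _ => ?_
          rw [← NNReal.coe_le_coe, Real.coe_toNNReal _ hε]
          exact hent i j
      _ = n * ε.toNNReal := by simp
  have h2 := NNReal.coe_le_coe.2 this
  simpa [Real.coe_toNNReal _ hε] using h2

/-- The squared length of `M x` is bounded by a multiple of the squared length of `x`. -/
theorem exists_dot_mulVec_le (M : Matrix (Fin m) (Fin n) ℝ) :
    ∃ b : ℝ, 0 ≤ b ∧ ∀ x, (M *ᵥ x) ⬝ᵥ (M *ᵥ x) ≤ b * (x ⬝ᵥ x) := by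
  refine ⟨‖Mᵀ * M‖, norm_nonneg _, fun x => ?_⟩
  have h := qf_mul_transpose Mᵀ x
  rw [Matrix.transpose_transpose] at h
  rw [← h]
  exact qf_le_norm (by simp) x

/-- A positive definite form is bounded below by a positive multiple of the squared length. -/
theorem exists_le_qf {M : Matrix (Fin n) (Fin n) ℝ} (h : M.PosDef) :
    ∃ b : ℝ, 0 < b ∧ ∀ x, b * (x ⬝ᵥ x) ≤ qf M x := by
  -- Cauchy-Schwarz for the form `M`, applied to `x` and `M⁻¹ x`
  obtain ⟨hs, hp⟩ := posDef_iff_qf.1 h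
  have hu : IsUnit M.det := (Matrix.isUnit_iff_isUnit_det _).1 h.isUnit
  have hi := transpose_of_posSemidef h.inv.posSemidef
  refine ⟨(‖M⁻¹‖ + 1)⁻¹, by positivity, fun x => ?_⟩
  have hc : 0 < ‖M⁻¹‖ + 1 := by positivity
  rw [inv_mul_le_iff₀ hc]
  have key := qf_nonneg h.posSemidef (x + (-(‖M⁻¹‖ + 1)⁻¹) • (M⁻¹ *ᵥ x))
  rw [qf_add_vec hs, qf_smul_vec, Matrix.mulVec_smul, Matrix.mulVec_mulVec,
    Matrix.mul_nonsing_inv _ hu, Matrix.one_mulVec, dotProduct_smul, smul_eq_mul] at key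
  have h2 : qf M (M⁻¹ *ᵥ x) ≤ (‖M⁻¹‖ + 1) * (x ⬝ᵥ x) := by
    have h3 : qf M (M⁻¹ *ᵥ x) = qf M⁻¹ x := by
      rw [qf, Matrix.mulVec_mulVec, Matrix.mul_nonsing_inv _ hu, Matrix.one_mulVec, qf,
        dotProduct_comm]
    rw [h3]
    nlinarith [qf_le_norm hi x, dot_self_nonneg x]
  set c := ‖M⁻¹‖ + 1
  have h4 : (-c⁻¹) ^ 2 * qf M (M⁻¹ *ᵥ x) ≤ c⁻¹ * (x ⬝ᵥ x) := by
    calc (-c⁻¹) ^ 2 * qf M (M⁻¹ *ᵥ x) ≤ (-c⁻¹) ^ 2 * (c * (x ⬝ᵥ x)) := by gcongr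
      _ = c⁻¹ * (x ⬝ᵥ x) := by field_simp
  have h5 : c⁻¹ * (x ⬝ᵥ x) ≤ qf M x := by linarith
  rwa [inv_mul_le_iff₀ hc] at h5

end Forms

/-! ### The standard Riccati map -/

section Riccati

variable {n p q : ℕ} (A : Matrix (Fin n) (Fin n) ℝ) (B : Matrix (Fin n) (Fin q) ℝ)
  (C : Matrix (Fin p) (Fin n) ℝ) (D : Matrix (Fin p) (Fin q) ℝ)

/-- The Kalman gain `A P Cᵀ (C P Cᵀ + R)⁻¹`. -/
noncomputable def gain (P : Matrix (Fin n) (Fin n) ℝ) : Matrix (Fin n) (Fin p) ℝ :=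
  A * P * Cᵀ * (C * P * Cᵀ + D * Dᵀ)⁻¹

/-- The error covariance after one step of the linear filter with gain `K`. -/
noncomputable def gainStep (K : Matrix (Fin n) (Fin p) ℝ) (P : Matrix (Fin n) (Fin n) ℝ) :
    Matrix (Fin n) (Fin n) ℝ :=
  (A - K * C) * P * (A - K * C)ᵀ + K * (D * Dᵀ) * Kᵀ + B * Bᵀ

variable {D}

theorem innovation_posDef (hD : (D * Dᵀ).PosDef) {P : Matrix (Fin n) (Fin n) ℝ}
    (hP : P.PosSemidef) : (C * P * Cᵀ + D * Dᵀ).PosDef := by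
  have h := hP.mul_mul_conjTranspose_same C
  rw [Matrix.conjTranspose_eq_transpose_of_trivial] at h
  exact Matrix.PosDef.posSemidef_add h hD

/-- Completion of squares: among all gains, the Kalman gain gives the least covariance. -/
theorem gainStep_eq_riccati_add (hD : (D * Dᵀ).PosDef) {P : Matrix (Fin n) (Fin n) ℝ}
    (hP : P.PosSemidef) (K : Matrix (Fin n) (Fin p) ℝ) :
    gainStep A B C D K P = riccati A B C D P
      + (K - gain A C D P) * (C * P * Cᵀ + D * Dᵀ) * (K - gain A C D P)ᵀ := by
  have hG := innovation_posDef C hD hP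
  have hdet : IsUnit (C * P * Cᵀ + D * Dᵀ).det := (Matrix.isUnit_iff_isUnit_det _).1 hG.isUnit
  have hGt : ((C * P * Cᵀ + D * Dᵀ)⁻¹)ᵀ = (C * P * Cᵀ + D * Dᵀ)⁻¹ :=
    transpose_of_posSemidef hG.inv.posSemidef
  have hPt := transpose_of_posSemidef hP
  have e1 : gain A C D P * (C * P * Cᵀ + D * Dᵀ) = A * P * Cᵀ := by
    rw [gain, Matrix.mul_assoc, Matrix.nonsing_inv_mul _ hdet, Matrix.mul_one]
  have e2 : (C * P * Cᵀ + D * Dᵀ) * (gain A C D P)ᵀ = C * P * Aᵀ := by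
    rw [gain, Matrix.transpose_mul, hGt, ← Matrix.mul_assoc, Matrix.mul_nonsing_inv _ hdet,
      Matrix.one_mul]
    simp only [Matrix.transpose_mul, Matrix.transpose_transpose, hPt, Matrix.mul_assoc]
  have e3 : riccati A B C D P = A * P * Aᵀ - gain A C D P * (C * P * Aᵀ) + B * Bᵀ := by
    simp only [riccati, gain, Matrix.mul_assoc]
  have e4 : (K - gain A C D P) * (C * P * Cᵀ + D * Dᵀ) * (K - gain A C D P)ᵀ
      = K * (C * P * Cᵀ + D * Dᵀ) * Kᵀ - A * P * Cᵀ * Kᵀ - K * (C * P * Aᵀ)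
        + gain A C D P * (C * P * Aᵀ) := by
    have e5 : gain A C D P * (C * P * Aᵀ) = A * P * Cᵀ * (gain A C D P)ᵀ := by
      rw [← e2, ← Matrix.mul_assoc, e1]
    rw [Matrix.transpose_sub, Matrix.sub_mul, e1, Matrix.mul_sub, Matrix.sub_mul, Matrix.sub_mul,
      Matrix.mul_assoc K _ (gain A C D P)ᵀ, e2, e5]
    abel
  rw [e3, e4, gainStep]
  simp only [Matrix.transpose_sub, Matrix.transpose_mul, Matrix.sub_mul, Matrix.mul_sub,
    Matrix.mul_add, Matrix.add_mul, Matrix.mul_assoc]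
  abel

theorem qf_gainStep (K : Matrix (Fin n) (Fin p) ℝ) (P : Matrix (Fin n) (Fin n) ℝ)
    (x : Fin n → ℝ) : qf (gainStep A B C D K P) x
      = qf P ((A - K * C)ᵀ *ᵥ x) + qf (K * (D * Dᵀ) * Kᵀ + B * Bᵀ) x := by
  rw [gainStep, add_assoc, qf_add, qf_conj]

theorem qf_riccati_le (hD : (D * Dᵀ).PosDef) {P : Matrix (Fin n) (Fin n) ℝ}
    (hP : P.PosSemidef) (K : Matrix (Fin n) (Fin p) ℝ) (x : Fin n → ℝ) :
    qf (riccati A B C D P) x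
      ≤ qf P ((A - K * C)ᵀ *ᵥ x) + qf (K * (D * Dᵀ) * Kᵀ + B * Bᵀ) x := by
  rw [← qf_gainStep, gainStep_eq_riccati_add A B C hD hP, qf_add, qf_conj]
  have := qf_nonneg (innovation_posDef C hD hP).posSemidef ((K - gain A C D P)ᵀ *ᵥ x)
  linarith

theorem qf_riccati (hD : (D * Dᵀ).PosDef) {P : Matrix (Fin n) (Fin n) ℝ}
    (hP : P.PosSemidef) (x : Fin n → ℝ) :
    qf (riccati A B C D P) x = qf P ((A - gain A C D P * C)ᵀ *ᵥ x)
      + qf (gain A C D P * (D * Dᵀ) * (gain A C D P)ᵀ + B * Bᵀ) x := by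
  rw [← qf_gainStep, gainStep_eq_riccati_add A B C hD hP, sub_self]
  simp

theorem transpose_riccati {P : Matrix (Fin n) (Fin n) ℝ} (hP : Pᵀ = P) :
    (riccati A B C D P)ᵀ = riccati A B C D P := by
  simp only [riccati, Matrix.transpose_add, Matrix.transpose_sub, Matrix.transpose_mul,
    Matrix.transpose_transpose, Matrix.transpose_nonsing_inv, hP, Matrix.mul_assoc]

theorem posSemidef_noise (hD : (D * Dᵀ).PosDef) (K : Matrix (Fin n) (Fin p) ℝ) :
    (K * (D * Dᵀ) * Kᵀ + B * Bᵀ).PosSemidef := by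
  have h := hD.posSemidef.mul_mul_conjTranspose_same K
  have h2 := Matrix.posSemidef_self_mul_conjTranspose B
  rw [Matrix.conjTranspose_eq_transpose_of_trivial] at h h2
  exact h.add h2

theorem posSemidef_riccati (hD : (D * Dᵀ).PosDef) {P : Matrix (Fin n) (Fin n) ℝ}
    (hP : P.PosSemidef) : (riccati A B C D P).PosSemidef := by
  refine posSemidef_iff_qf.2 ⟨transpose_riccati A B C (transpose_of_posSemidef hP), fun x => ?_⟩
  rw [qf_riccati A B C hD hP]
  exact add_nonneg (qf_nonneg hP _) (qf_nonneg (posSemidef_noise B hD _) _)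

/-- The increment of the Riccati map from `P'` to `P` is at most the increment of its argument,
transported by the closed loop of the Kalman gain of `P'`. -/
theorem qf_riccati_sub_le (hD : (D * Dᵀ).PosDef) {P P' : Matrix (Fin n) (Fin n) ℝ}
    (hP : P.PosSemidef) (hP' : P'.PosSemidef) (x : Fin n → ℝ) :
    qf (riccati A B C D P) x - qf (riccati A B C D P') x
      ≤ qf (P - P') ((A - gain A C D P' * C)ᵀ *ᵥ x) := by
  rw [qf_riccati A B C hD hP', qf_sub]
  have := qf_riccati_le A B C hD hP (gain A C D P') x
  linarith

theorem qf_riccati_mono (hD : (D * Dᵀ).PosDef) {P P' : Matrix (Fin n) (Fin n) ℝ}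
    (hP : P.PosSemidef) (hP' : P'.PosSemidef) (h : ∀ x, qf P x ≤ qf P' x) (x : Fin n → ℝ) :
    qf (riccati A B C D P) x ≤ qf (riccati A B C D P') x := by
  have h1 := qf_riccati_sub_le A B C hD hP hP' x
  rw [qf_sub] at h1
  linarith [h ((A - gain A C D P' * C)ᵀ *ᵥ x)]

theorem posSemidef_riccati_iterate (hD : (D * Dᵀ).PosDef) {P : Matrix (Fin n) (Fin n) ℝ}
    (hP : P.PosSemidef) (t : ℕ) : ((riccati A B C D)^[t] P).PosSemidef := by
  induction t with
  | zero => exact hP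
  | succ t ih =>
    rw [Function.iterate_succ_apply']
    exact posSemidef_riccati A B C hD ih

theorem qf_riccati_iterate_mono (hD : (D * Dᵀ).PosDef) {P P' : Matrix (Fin n) (Fin n) ℝ}
    (hP : P.PosSemidef) (hP' : P'.PosSemidef) (h : ∀ x, qf P x ≤ qf P' x) (t : ℕ) (x : Fin n → ℝ) :
    qf ((riccati A B C D)^[t] P) x ≤ qf ((riccati A B C D)^[t] P') x := by
  induction t generalizing x with
  | zero => exact h x
  | succ t ih =>
    rw [Function.iterate_succ_apply', Function.iterate_succ_apply']
    exact qf_riccati_mono A B C hD (posSemidef_riccati_iterate A B C hD hP t)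
      (posSemidef_riccati_iterate A B C hD hP' t) ih x

theorem continuousAt_matrix_mul {X : Type*} [TopologicalSpace X] {k l m : ℕ} {x : X}
    {f : X → Matrix (Fin k) (Fin l) ℝ} {g : X → Matrix (Fin l) (Fin m) ℝ}
    (hf : ContinuousAt f x) (hg : ContinuousAt g x) : ContinuousAt (fun y => f y * g y) x :=
  (continuous_fst.matrix_mul continuous_snd).continuousAt.comp (hf.prodMk hg)

theorem continuousAt_innovation_inv (hD : (D * Dᵀ).PosDef) {P : Matrix (Fin n) (Fin n) ℝ}
    (hP : P.PosSemidef) :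
    ContinuousAt (fun X : Matrix (Fin n) (Fin n) ℝ => (C * X * Cᵀ + D * Dᵀ)⁻¹) P := by
  have hdet : (C * P * Cᵀ + D * Dᵀ).det ≠ 0 :=
    ((Matrix.isUnit_iff_isUnit_det _).1 (innovation_posDef C hD hP).isUnit).ne_zero
  have h1 : Continuous fun X : Matrix (Fin n) (Fin n) ℝ => C * X * Cᵀ + D * Dᵀ := by fun_prop
  simp only [Matrix.inv_def, Ring.inverse_eq_inv']
  have h2 := h1.matrix_det.continuousAt.inv₀ hdet
  exact ContinuousAt.smul h2 h1.matrix_adjugate.continuousAt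

theorem continuousAt_gain (hD : (D * Dᵀ).PosDef) {P : Matrix (Fin n) (Fin n) ℝ}
    (hP : P.PosSemidef) : ContinuousAt (gain A C D) P := by
  have h1 : ContinuousAt (fun X : Matrix (Fin n) (Fin n) ℝ => A * X * Cᵀ) P := by fun_prop
  exact continuousAt_matrix_mul h1 (continuousAt_innovation_inv C hD hP)

theorem continuousAt_riccati (hD : (D * Dᵀ).PosDef) {P : Matrix (Fin n) (Fin n) ℝ}
    (hP : P.PosSemidef) : ContinuousAt (riccati A B C D) P := by
  have h : riccati A B C D = fun X => A * X * Aᵀ - gain A C D X * (C * X * Aᵀ) + B * Bᵀ := by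
    funext X
    simp only [riccati, gain, Matrix.mul_assoc]
  rw [h]
  have h1 : ContinuousAt (fun X : Matrix (Fin n) (Fin n) ℝ => C * X * Aᵀ) P := by fun_prop
  have h2 : ContinuousAt (fun X : Matrix (Fin n) (Fin n) ℝ => A * X * Aᵀ) P := by fun_prop
  exact (h2.sub (continuousAt_matrix_mul (continuousAt_gain A C hD hP) h1)).add continuousAt_const

end Riccati

/-! ### Boundedness of the Riccati iteration from zero -/

section Deadbeat

variable {n p q : ℕ} (A : Matrix (Fin n) (Fin n) ℝ) (B : Matrix (Fin n) (Fin q) ℝ)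
  (C : Matrix (Fin p) (Fin n) ℝ) (D : Matrix (Fin p) (Fin q) ℝ)

theorem riccati_mulVec_mem {V : Submodule ℝ (Fin n → ℝ)} (hA : ∀ x ∈ V, A *ᵥ x ∈ V)
    (hB : ∀ u, B *ᵥ u ∈ V) {P : Matrix (Fin n) (Fin n) ℝ} (hP : ∀ x, P *ᵥ x ∈ V)
    (x : Fin n → ℝ) : riccati A B C D P *ᵥ x ∈ V := by
  have h : riccati A B C D P *ᵥ x = A *ᵥ (P *ᵥ (Aᵀ *ᵥ x))
      - A *ᵥ (P *ᵥ ((Cᵀ * (C * P * Cᵀ + D * Dᵀ)⁻¹ * C * P * Aᵀ) *ᵥ x)) + B *ᵥ (Bᵀ *ᵥ x) := by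
    simp only [riccati, Matrix.add_mulVec, Matrix.sub_mulVec, Matrix.mulVec_mulVec,
      Matrix.mul_assoc]
  rw [h]
  exact V.add_mem (V.sub_mem (hA _ (hP _)) (hA _ (hP _))) (hB _)

theorem mulVec_mem_reachableSubspace {x : Fin n → ℝ} (hx : x ∈ reachableSubspace A B) :
    A *ᵥ x ∈ reachableSubspace A B := by
  have h : (reachableSubspace A B).map A.mulVecLin ≤ reachableSubspace A B := by
    rw [reachableSubspace, Submodule.map_iSup]
    refine iSup_le fun k => le_trans ?_ (le_iSup _ (k + 1))
    rw [← LinearMap.range_comp, ← Matrix.mulVecLin_mul, pow_succ', Matrix.mul_assoc]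
  exact h ⟨x, hx, rfl⟩

theorem input_mem_reachableSubspace (u : Fin q → ℝ) : B *ᵥ u ∈ reachableSubspace A B := by
  refine (le_iSup (fun k : ℕ => LinearMap.range (A ^ k * B).mulVecLin) 0) ⟨u, ?_⟩
  simp

/-- The products `(A - Kₛ C) ⋯ (A - K₁ C)`: transition matrices of the estimation error for
time-varying gains. -/
inductive IsGainProduct : Matrix (Fin n) (Fin n) ℝ → Prop
  | one : IsGainProduct 1
  | step (K : Matrix (Fin n) (Fin p) ℝ) {Φ : Matrix (Fin n) (Fin n) ℝ} :
      IsGainProduct Φ → IsGainProduct ((A - K * C) * Φ)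

theorem IsGainProduct.pow_mul {Φ : Matrix (Fin n) (Fin n) ℝ} (h : IsGainProduct A C Φ) (k : ℕ) :
    IsGainProduct A C (A ^ k * Φ) := by
  induction k with
  | zero => simpa using h
  | succ k ih =>
    have h2 := IsGainProduct.step (A := A) (C := C) 0 ih
    rwa [Matrix.zero_mul, sub_zero, ← Matrix.mul_assoc, ← pow_succ'] at h2

variable {D} in
/-- A suboptimal time-varying filter bounds the iterated Riccati map by an affine function. -/
theorem IsGainProduct.exists_bound (hD : (D * Dᵀ).PosDef) {Φ : Matrix (Fin n) (Fin n) ℝ}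
    (h : IsGainProduct A C Φ) : ∃ (N : ℕ) (W : Matrix (Fin n) (Fin n) ℝ),
      ∀ P : Matrix (Fin n) (Fin n) ℝ, P.PosSemidef → ∀ x,
        qf ((riccati A B C D)^[N] P) x ≤ qf P (Φᵀ *ᵥ x) + qf W x := by
  induction h with
  | one => exact ⟨0, 0, fun P _ x => by simp [qf_zero]⟩
  | @step K Φ _ ih =>
    obtain ⟨N, W, hW⟩ := ih
    refine ⟨N + 1, (A - K * C) * W * (A - K * C)ᵀ + (K * (D * Dᵀ) * Kᵀ + B * Bᵀ),
      fun P hP x => ?_⟩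
    rw [Function.iterate_succ_apply']
    have h1 := qf_riccati_le A B C hD (posSemidef_riccati_iterate A B C hD hP N) K x
    have h2 := hW P hP ((A - K * C)ᵀ *ᵥ x)
    rw [Matrix.mulVec_mulVec, ← Matrix.transpose_mul] at h2
    rw [qf_add, qf_conj]
    linarith

/-- Observability of the reachable subsystem yields a dead-beat filter: time-varying gains for
which the estimation error on the reachable subspace vanishes after finitely many steps. As long as
the image of the reachable subspace is not zero, some iterate of it is seen by `C`, and a rank-one
gain annihilates a direction in it. -/
theorem exists_deadbeat (hobs : ReachableSubsystemObservable A B C) :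
    ∃ Φ, IsGainProduct A C Φ ∧ ∀ x ∈ reachableSubspace A B, Φ *ᵥ x = 0 := by
  set V := reachableSubspace A B with hV
  have key : ∀ d : ℕ, ∀ Φ : Matrix (Fin n) (Fin n) ℝ, IsGainProduct A C Φ →
      (∀ x ∈ V, Φ *ᵥ x ∈ V) → Module.finrank ℝ (V.map Φ.mulVecLin) = d →
      ∃ Φ', IsGainProduct A C Φ' ∧ ∀ x ∈ V, Φ' *ᵥ x = 0 := by
    intro d
    induction d using Nat.strong_induction_on with
    | _ d ih =>
    intro Φ hΦ hΦV hd
    by_cases hz : ∀ x ∈ V, Φ *ᵥ x = 0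
    · exact ⟨Φ, hΦ, hz⟩
    push Not at hz
    obtain ⟨x, hxV, hx⟩ := hz
    obtain ⟨k, hk⟩ : ∃ k : ℕ, (C * A ^ k) *ᵥ (Φ *ᵥ x) ≠ 0 := by
      by_contra! hcon
      exact hx (hobs _ (hΦV x hxV) hcon)
    have hpowV : ∀ (k : ℕ), ∀ y ∈ V, (A ^ k) *ᵥ y ∈ V := by
      intro k
      induction k with
      | zero => intro y hy; simpa using hy
      | succ k ihk =>
        intro y hy
        rw [pow_succ', ← Matrix.mulVec_mulVec]
        exact mulVec_mem_reachableSubspace A B (ihk y hy)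
    set w := (A ^ k) *ᵥ (Φ *ᵥ x) with hw
    have hCw : C *ᵥ w ≠ 0 := by rwa [hw, Matrix.mulVec_mulVec]
    have hw0 : w ≠ 0 := by
      rintro h0
      rw [h0, Matrix.mulVec_zero] at hCw
      exact hCw rfl
    have hwV : w ∈ V := hpowV k _ (hΦV x hxV)
    set s := (C *ᵥ w) ⬝ᵥ (C *ᵥ w) with hs
    have hs0 : s ≠ 0 := fun h => hCw (dotProduct_self_eq_zero.1 h)
    set K : Matrix (Fin n) (Fin p) ℝ := s⁻¹ • vecMulVec (A *ᵥ w) (C *ᵥ w) with hK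
    have hKv : ∀ v, K *ᵥ v = (s⁻¹ * ((C *ᵥ w) ⬝ᵥ v)) • (A *ᵥ w) := fun v => by
      rw [hK, Matrix.smul_mulVec, Matrix.vecMulVec_mulVec, op_smul_eq_smul, smul_smul]
    have hkill : (A - K * C) *ᵥ w = 0 := by
      rw [Matrix.sub_mulVec, ← Matrix.mulVec_mulVec, hKv, ← hs, inv_mul_cancel₀ hs0, one_smul,
        sub_self]
    have hAKV : ∀ y ∈ V, (A - K * C) *ᵥ y ∈ V := fun y hy => by
      rw [Matrix.sub_mulVec, ← Matrix.mulVec_mulVec, hKv]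
      exact V.sub_mem (mulVec_mem_reachableSubspace A B hy)
        (V.smul_mem _ (mulVec_mem_reachableSubspace A B hwV))
    refine ih _ ?_ ((A - K * C) * (A ^ k * Φ)) (.step K (hΦ.pow_mul A C k)) (fun y hy => ?_) rfl
    · set W := V.map (A ^ k * Φ).mulVecLin with hW
      have hWle : Module.finrank ℝ W ≤ d := by
        rw [hW, Matrix.mulVecLin_mul, Submodule.map_comp, ← hd]
        exact Submodule.finrank_map_le _ _
      have hwW : w ∈ W := ⟨x, hxV, by simp [hw, Matrix.mulVec_mulVec]⟩
      refine lt_of_lt_of_le ?_ hWle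
      rw [Matrix.mulVecLin_mul, Submodule.map_comp, ← hW]
      have hrn := LinearMap.finrank_range_add_finrank_ker ((A - K * C).mulVecLin.domRestrict W)
      rw [LinearMap.range_domRestrict] at hrn
      have hpos : 0 < Module.finrank ℝ (LinearMap.ker ((A - K * C).mulVecLin.domRestrict W)) := by
        refine Nat.pos_of_ne_zero fun h => ?_
        have hbot := Submodule.finrank_eq_zero.1 h
        have hmem : (⟨w, hwW⟩ : W) ∈ LinearMap.ker ((A - K * C).mulVecLin.domRestrict W) := by
          exact LinearMap.mem_ker.2 hkill
        rw [hbot, Submodule.mem_bot, Subtype.ext_iff] at hmem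
        exact hw0 hmem
      omega
    · rw [← Matrix.mulVec_mulVec, ← Matrix.mulVec_mulVec]
      exact hAKV _ (hpowV k _ (hΦV y hy))
  exact key _ 1 .one (fun x hx => by simpa using hx) rfl

variable {D} in
/-- The Riccati iteration started at zero increases to a positive semidefinite fixed point. -/
theorem exists_riccati_fixedPoint (hD : (D * Dᵀ).PosDef)
    (hobs : ReachableSubsystemObservable A B C) :
    ∃ Pbar : Matrix (Fin n) (Fin n) ℝ, Pbar.PosSemidef ∧ riccati A B C D Pbar = Pbar ∧
      Tendsto (fun t : ℕ => (riccati A B C D)^[t] 0) atTop (𝓝 Pbar) ∧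
      ∀ (t : ℕ) x, qf ((riccati A B C D)^[t] 0) x ≤ qf Pbar x := by
  have h0 : (0 : Matrix (Fin n) (Fin n) ℝ).PosSemidef := Matrix.PosSemidef.zero
  have hpsd := fun t => posSemidef_riccati_iterate A B C hD h0 t
  have hmono : ∀ x, Monotone fun t : ℕ => qf ((riccati A B C D)^[t] 0) x := fun x =>
    monotone_nat_of_le_succ fun t => by
      rw [Function.iterate_succ_apply]
      refine qf_riccati_iterate_mono A B C hD h0 (posSemidef_riccati A B C hD h0) (fun y => ?_) t x
      rw [qf_zero]
      exact qf_nonneg (posSemidef_riccati A B C hD h0) y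
  obtain ⟨Φ, hΦ, hΦV⟩ := exists_deadbeat A B C hobs
  obtain ⟨N, W, hW⟩ := hΦ.exists_bound A B C hD
  have hmem : ∀ (t : ℕ) x, (riccati A B C D)^[t] 0 *ᵥ x ∈ reachableSubspace A B := by
    intro t
    induction t with
    | zero => intro x; simp
    | succ t ih =>
      rw [Function.iterate_succ_apply']
      exact riccati_mulVec_mem A B C D (fun y hy => mulVec_mem_reachableSubspace A B hy)
        (input_mem_reachableSubspace A B) ih
  have hb : ∀ (t : ℕ) x, qf ((riccati A B C D)^[t] 0) x ≤ qf W x := fun t x => by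
    refine (hmono x (Nat.le_add_left t N)).trans ?_
    have h1 := hW _ (hpsd t) x
    rw [← Function.iterate_add_apply, ← qf_conj] at h1
    have h2 : Φ * (riccati A B C D)^[t] 0 * Φᵀ = 0 := by
      have : Φ * (riccati A B C D)^[t] 0 = 0 :=
        Matrix.ext_of_mulVec_single fun i => by
          rw [← Matrix.mulVec_mulVec, hΦV _ (hmem t _), Matrix.zero_mulVec]
      rw [this, Matrix.zero_mul]
    rwa [h2, qf_zero, zero_add] at h1
  obtain ⟨L, hL, hlim⟩ := exists_tendsto_of_monotone
    (fun t => transpose_of_posSemidef (hpsd t)) hmono W hb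
  have hle : ∀ (t : ℕ) x, qf ((riccati A B C D)^[t] 0) x ≤ qf L x := fun t x =>
    (hmono x).ge_of_tendsto (((continuous_qf x).tendsto L).comp hlim) t
  have hLpsd : L.PosSemidef := posSemidef_iff_qf.2 ⟨hL, fun x =>
    (qf_nonneg h0 x).trans (hle 0 x)⟩
  refine ⟨L, hLpsd, ?_, hlim, hle⟩
  have h1 := (continuousAt_riccati A B C hD hLpsd).tendsto.comp hlim
  have h2 := hlim.comp (tendsto_add_atTop_nat 1)
  refine tendsto_nhds_unique h1 (h2.congr fun t => ?_)
  simp [Function.iterate_succ_apply']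

end Deadbeat

/-! ### A Lyapunov function for the closed loop -/

section Lyapunov

variable {n p q : ℕ}

/-- Powers of a Schur stable matrix tend to zero, by Gelfand's formula. -/
theorem IsSchurStable.tendsto_pow {G : Matrix (Fin n) (Fin n) ℝ} (hG : IsSchurStable G) :
    Tendsto (fun k : ℕ => G ^ k) atTop (𝓝 0) := by
  rcases n.eq_zero_or_pos with rfl | hn
  · exact tendsto_const_nhds.congr fun _ => Subsingleton.elim _ _
  have : Nonempty (Fin n) := ⟨⟨0, hn⟩⟩
  have : CompleteSpace (Matrix (Fin n) (Fin n) ℂ) := FiniteDimensional.complete ℂ _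
  set M : Matrix (Fin n) (Fin n) ℂ := G.map (fun x : ℝ => (x : ℂ)) with hM
  have hr : spectralRadius ℂ M < (1 : NNReal) :=
    spectrum.spectralRadius_lt_of_forall_lt M fun z hz => by
      rw [← NNReal.coe_lt_coe]
      exact hG z hz
  obtain ⟨r, hr1, hr2⟩ := ENNReal.lt_iff_exists_nnreal_btwn.1 hr
  have hev :=
    (spectrum.pow_nnnorm_pow_one_div_tendsto_nhds_spectralRadius M).eventually_lt_const hr1
  have hr1' : r < 1 := by exact_mod_cast hr2
  have hM0 : Tendsto (fun k : ℕ => M ^ k) atTop (𝓝 0) := by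
    refine squeeze_zero_norm' ?_
      (tendsto_pow_atTop_nhds_zero_of_lt_one r.coe_nonneg (NNReal.coe_lt_coe.2 hr1'))
    filter_upwards [hev, eventually_gt_atTop 0] with k hk hk0
    have hk' : (0 : ℝ) < k := by exact_mod_cast hk0
    have h1 : (‖M ^ k‖₊ : ENNReal) ≤ (r : ENNReal) ^ (k : ℝ) := by
      rw [one_div, ENNReal.rpow_inv_lt_iff hk'] at hk
      exact hk.le
    rw [ENNReal.rpow_natCast] at h1
    have h2 : ‖M ^ k‖₊ ≤ r ^ k := by exact_mod_cast h1
    exact_mod_cast h2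
  have hre : ∀ k : ℕ, G ^ k = (M ^ k).map Complex.re := fun k => by
    have h1 : M ^ k = (G ^ k).map (fun x : ℝ => (x : ℂ)) :=
      (map_pow (Complex.ofRealHom.mapMatrix (m := Fin n)) G k).symm
    rw [h1]
    ext i j
    simp
  have hc : Continuous fun X : Matrix (Fin n) (Fin n) ℂ => X.map Complex.re :=
    continuous_id.matrix_map Complex.continuous_re
  have h3 := (hc.tendsto 0).comp hM0
  have h4 : ((0 : Matrix (Fin n) (Fin n) ℂ).map Complex.re) = 0 := by ext i j; simp
  rw [h4] at h3
  exact h3.congr fun k => (hre k).symm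

/-- A Schur stable matrix admits a quadratic Lyapunov function; a finite sum `∑ Gⁱ Gⁱᵀ` does. -/
theorem IsSchurStable.exists_lyapunov {G : Matrix (Fin n) (Fin n) ℝ} (hG : IsSchurStable G) :
    ∃ (S : Matrix (Fin n) (Fin n) ℝ) (ρ : ℝ), Sᵀ = S ∧ (∀ x, x ⬝ᵥ x ≤ qf S x) ∧ 0 < ρ ∧ ρ < 1 ∧
      ∀ x, qf S (Gᵀ *ᵥ x) ≤ ρ * qf S x := by
  have hc : Continuous fun X : Matrix (Fin n) (Fin n) ℝ => ‖X * Xᵀ‖ := by fun_prop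
  have h1 := (hc.tendsto 0).comp hG.tendsto_pow
  simp only [Matrix.zero_mul, norm_zero] at h1
  obtain ⟨N, hN⟩ := ((tendsto_add_atTop_iff_nat 1).2 h1).eventually_le_const
    (show (0 : ℝ) < 1 / 2 by norm_num) |>.exists
  simp only [Function.comp_apply] at hN
  set S : Matrix (Fin n) (Fin n) ℝ := ∑ i ∈ Finset.range (N + 1), G ^ i * (G ^ i)ᵀ with hS
  have hSt : Sᵀ = S := by
    rw [hS, Matrix.transpose_sum]
    exact Finset.sum_congr rfl fun i _ => by simp
  have hterm : ∀ (i : ℕ) x, 0 ≤ qf (G ^ i * (G ^ i)ᵀ) x := fun i x => by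
    rw [qf_mul_transpose]
    exact dot_self_nonneg _
  have hlow : ∀ x, x ⬝ᵥ x ≤ qf S x := fun x => by
    rw [hS, qf_sum, Finset.sum_range_succ']
    have h2 : 0 ≤ ∑ i ∈ Finset.range N, qf (G ^ (i + 1) * (G ^ (i + 1))ᵀ) x :=
      Finset.sum_nonneg fun i _ => hterm _ x
    simpa [qf_one] using h2
  have hstep : ∀ x, qf S (Gᵀ *ᵥ x) = qf S x - x ⬝ᵥ x + qf (G ^ (N + 1) * (G ^ (N + 1))ᵀ) x :=
    fun x => by
    have h2 : qf S (Gᵀ *ᵥ x) = ∑ i ∈ Finset.range (N + 1), qf (G ^ (i + 1) * (G ^ (i + 1))ᵀ) x := by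
      rw [hS, qf_sum]
      refine Finset.sum_congr rfl fun i _ => ?_
      rw [← qf_conj, pow_succ' G i, Matrix.transpose_mul]
      simp only [Matrix.mul_assoc]
    rw [h2, Finset.sum_range_succ, hS, qf_sum, Finset.sum_range_succ']
    simp [qf_one]
  refine ⟨S, 1 - (2 * (‖S‖ + 1))⁻¹, hSt, hlow, ?_, ?_, fun x => ?_⟩
  · have : (2 * (‖S‖ + 1))⁻¹ < 1 := inv_lt_one_of_one_lt₀ (by linarith [norm_nonneg S])
    linarith
  · have : 0 < (2 * (‖S‖ + 1))⁻¹ := by positivity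
    linarith
  · rw [hstep]
    have h2 : qf (G ^ (N + 1) * (G ^ (N + 1))ᵀ) x ≤ 1 / 2 * (x ⬝ᵥ x) :=
      (qf_le_norm (by simp) x).trans (mul_le_mul_of_nonneg_right hN (dot_self_nonneg x))
    have h3 : (2 * (‖S‖ + 1))⁻¹ * qf S x ≤ 1 / 2 * (x ⬝ᵥ x) := by
      rw [inv_mul_le_iff₀ (by positivity)]
      nlinarith [qf_le_norm hSt x, dot_self_nonneg x]
    linarith

/-- The closed loop of the Kalman gain of a fixed point of the Riccati map is stable: it has a
quadratic Lyapunov function. The fixed point itself decreases along the closed loop by the energy of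
the noise inputs, and up to these inputs the closed loop is a stabilized system `A + B K`. -/
theorem exists_closedLoop_lyapunov {A : Matrix (Fin n) (Fin n) ℝ} {B : Matrix (Fin n) (Fin q) ℝ}
    (C : Matrix (Fin p) (Fin n) ℝ) {D : Matrix (Fin p) (Fin q) ℝ} (hD : (D * Dᵀ).PosDef)
    (hstab : Stabilizable A B) {Pbar : Matrix (Fin n) (Fin n) ℝ} (hP : Pbar.PosSemidef)
    (hfix : riccati A B C D Pbar = Pbar) :
    ∃ (W : Matrix (Fin n) (Fin n) ℝ) (ρ : ℝ), Wᵀ = W ∧ (∀ x, x ⬝ᵥ x ≤ qf W x) ∧ 0 < ρ ∧ ρ < 1 ∧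
      ∀ x, qf W ((A - gain A C D Pbar * C)ᵀ *ᵥ x) ≤ ρ * qf W x := by
  obtain ⟨K, hK⟩ := hstab
  obtain ⟨S, ρ, hSt, hlow, hρ0, hρ1, hSρ⟩ := hK.exists_lyapunov
  set L := gain A C D Pbar with hL
  set F := A - L * C with hF
  obtain ⟨k₁, hk₁, hK1⟩ := exists_dot_mulVec_le Kᵀ
  obtain ⟨k₂, hk₂, hK2⟩ := exists_dot_mulVec_le Cᵀ
  obtain ⟨r₀, hr₀, hR⟩ := exists_le_qf hD
  have hSnn : ∀ x, 0 ≤ qf S x := fun x => (dot_self_nonneg x).trans (hlow x)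
  set N := L * (D * Dᵀ) * Lᵀ + B * Bᵀ with hN
  have hNx : ∀ x, qf N x = qf (D * Dᵀ) (Lᵀ *ᵥ x) + (Bᵀ *ᵥ x) ⬝ᵥ (Bᵀ *ᵥ x) := fun x => by
    rw [hN, qf_add, qf_conj L, qf_mul_transpose B]
  have hdec : ∀ x, qf Pbar x = qf Pbar (Fᵀ *ᵥ x) + qf N x := fun x => by
    have := qf_riccati A B C hD hP x
    rwa [hfix] at this
  have hsq : ∀ a b : Fin n → ℝ, (a + b) ⬝ᵥ (a + b) ≤ 2 * (a ⬝ᵥ a) + 2 * (b ⬝ᵥ b) := fun a b => by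
    have h := dot_self_nonneg (a - b)
    simp only [sub_dotProduct, dotProduct_sub, add_dotProduct, dotProduct_add] at h ⊢
    linarith
  set α := (1 - ρ) / (2 * ρ) with hα
  have hα0 : 0 < α := by
    rw [hα]
    have : 0 < 1 - ρ := by linarith
    positivity
  have hαρ : (1 + α) * ρ = (1 + ρ) / 2 := by
    rw [hα]
    field_simp
    ring
  set κ := (1 + 1 / α) * (‖S‖ * (2 * k₁ + 2 * k₂ / r₀)) with hκ
  have hκ0 : 0 ≤ κ := by positivity
  have hSF : ∀ x, qf S (Fᵀ *ᵥ x) ≤ (1 + ρ) / 2 * qf S x + κ * qf N x := fun x => by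
    set a := (A + B * K)ᵀ *ᵥ x with ha
    set v := Kᵀ *ᵥ (Bᵀ *ᵥ x) + Cᵀ *ᵥ (Lᵀ *ᵥ x) with hv
    have hFx : Fᵀ *ᵥ x = a + (-1 : ℝ) • v := by
      rw [hF, ha, hv]
      simp only [Matrix.transpose_sub, Matrix.transpose_add, Matrix.transpose_mul,
        Matrix.sub_mulVec, Matrix.add_mulVec, Matrix.mulVec_mulVec, neg_smul, one_smul]
      abel
    have hv2 : v ⬝ᵥ v ≤ (2 * k₁ + 2 * k₂ / r₀) * qf N x := by
      have e1 := hsq (Kᵀ *ᵥ (Bᵀ *ᵥ x)) (Cᵀ *ᵥ (Lᵀ *ᵥ x))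
      have e2 := hK1 (Bᵀ *ᵥ x)
      have e3 := hK2 (Lᵀ *ᵥ x)
      have e4 := hR (Lᵀ *ᵥ x)
      have e5 : (Bᵀ *ᵥ x) ⬝ᵥ (Bᵀ *ᵥ x) ≤ qf N x := by
        rw [hNx]
        linarith [qf_nonneg hD.posSemidef (Lᵀ *ᵥ x)]
      have e6 : (Lᵀ *ᵥ x) ⬝ᵥ (Lᵀ *ᵥ x) ≤ qf N x / r₀ := by
        rw [le_div_iff₀ hr₀, hNx, mul_comm]
        linarith [dot_self_nonneg (Bᵀ *ᵥ x)]
      have e7 := mul_le_mul_of_nonneg_left e5 hk₁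
      have e8 := mul_le_mul_of_nonneg_left e6 hk₂
      calc v ⬝ᵥ v ≤ 2 * (k₁ * qf N x) + 2 * (k₂ * (qf N x / r₀)) := by linarith
        _ = (2 * k₁ + 2 * k₂ / r₀) * qf N x := by ring
    have hSv : qf S v ≤ ‖S‖ * (2 * k₁ + 2 * k₂ / r₀) * qf N x := by
      refine (qf_le_norm hSt v).trans ?_
      rw [mul_assoc]
      exact mul_le_mul_of_nonneg_left hv2 (norm_nonneg _)
    -- weighted Cauchy-Schwarz splits off `v` at the price of the factor `1 + α`
    have hcs := hSnn (α • a + v)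
    rw [qf_add_vec hSt, qf_smul_vec, smul_dotProduct, smul_eq_mul] at hcs
    have hexp : qf S (Fᵀ *ᵥ x) = qf S a - 2 * (a ⬝ᵥ S *ᵥ v) + qf S v := by
      rw [hFx, qf_add_vec hSt, qf_smul_vec, Matrix.mulVec_smul, dotProduct_smul, smul_eq_mul]
      ring
    have hcs2 : -(2 * (a ⬝ᵥ S *ᵥ v)) ≤ α * qf S a + 1 / α * qf S v := by
      have h1 : 0 ≤ 1 / α * (α ^ 2 * qf S a + 2 * (α * (a ⬝ᵥ S *ᵥ v)) + qf S v) :=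
        mul_nonneg (by positivity) hcs
      have h2 : 1 / α * (α ^ 2 * qf S a + 2 * (α * (a ⬝ᵥ S *ᵥ v)) + qf S v)
          = α * qf S a + 2 * (a ⬝ᵥ S *ᵥ v) + 1 / α * qf S v := by
        field_simp
      linarith
    have h3 : (1 + α) * qf S a ≤ (1 + ρ) / 2 * qf S x := by
      rw [← hαρ, mul_assoc]
      exact mul_le_mul_of_nonneg_left (hSρ x) (by positivity)
    have h4 : (1 + 1 / α) * qf S v ≤ κ * qf N x := by
      rw [hκ, mul_assoc (1 + 1 / α)]
      exact mul_le_mul_of_nonneg_left hSv (by positivity)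
    linarith
  set β := κ * ‖Pbar‖ with hβ
  have hβ0 : 0 ≤ β := by positivity
  have hPt := transpose_of_posSemidef hP
  refine ⟨S + κ • Pbar, ((1 + ρ) / 2 + β) / (1 + β), ?_, fun x => ?_, by positivity, ?_,
    fun x => ?_⟩
  · simp [hSt, hPt]
  · rw [qf_add, qf_smul]
    linarith [hlow x, mul_nonneg hκ0 (qf_nonneg hP x)]
  · rw [div_lt_one (by positivity)]
    linarith
  · rw [qf_add, qf_smul, qf_add, qf_smul, div_mul_eq_mul_div, le_div_iff₀ (by positivity)]
    have h1 := hSF x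
    have h2 : κ * qf Pbar x ≤ β * qf S x := by
      rw [hβ, mul_assoc κ]
      refine mul_le_mul_of_nonneg_left ((qf_le_norm hPt x).trans ?_) hκ0
      exact mul_le_mul_of_nonneg_left (hlow x) (norm_nonneg _)
    have h3 : qf S (Fᵀ *ᵥ x) + κ * qf Pbar (Fᵀ *ᵥ x)
        ≤ (1 + ρ) / 2 * qf S x + κ * qf Pbar x := by
      rw [hdec x]
      linarith
    have h4 := mul_le_mul_of_nonneg_right h3 (show 0 ≤ 1 + β by positivity)
    nlinarith [mul_nonneg (show 0 ≤ (1 - ρ) / 2 by linarith) (sub_nonneg.2 h2)]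

/-- All standard Riccati iterations have the same limit: they lie above the iteration from zero, and
exceed the fixed point by at most a geometrically decaying multiple of the Lyapunov function. -/
theorem tendsto_riccati_iterate {A : Matrix (Fin n) (Fin n) ℝ} {B : Matrix (Fin n) (Fin q) ℝ}
    (C : Matrix (Fin p) (Fin n) ℝ) {D : Matrix (Fin p) (Fin q) ℝ} (hD : (D * Dᵀ).PosDef)
    {Pbar : Matrix (Fin n) (Fin n) ℝ} (hP : Pbar.PosSemidef)
    (hfix : riccati A B C D Pbar = Pbar)
    (hzero : Tendsto (fun t : ℕ => (riccati A B C D)^[t] 0) atTop (𝓝 Pbar))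
    {W : Matrix (Fin n) (Fin n) ℝ} {ρ : ℝ} (hlow : ∀ x, x ⬝ᵥ x ≤ qf W x) (hρ0 : 0 < ρ)
    (hρ1 : ρ < 1) (hW : ∀ x, qf W ((A - gain A C D Pbar * C)ᵀ *ᵥ x) ≤ ρ * qf W x)
    {P₀ : Matrix (Fin n) (Fin n) ℝ} (hP₀ : P₀.PosSemidef) :
    Tendsto (fun t : ℕ => (riccati A B C D)^[t] P₀) atTop (𝓝 Pbar) := by
  have hPt := transpose_of_posSemidef hP
  have hpsd := fun t => posSemidef_riccati_iterate A B C hD hP₀ t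
  have hup : ∀ (t : ℕ) x, qf ((riccati A B C D)^[t] P₀ - Pbar) x
      ≤ ‖P₀ - Pbar‖ * ρ ^ t * qf W x := by
    intro t
    induction t with
    | zero =>
      intro x
      rw [pow_zero, mul_one]
      refine (qf_le_norm ?_ x).trans (mul_le_mul_of_nonneg_left (hlow x) (norm_nonneg _))
      rw [Function.iterate_zero, id, Matrix.transpose_sub, transpose_of_posSemidef hP₀, hPt]
    | succ t ih =>
      intro x
      rw [Function.iterate_succ_apply']
      have h1 := qf_riccati_sub_le A B C hD (hpsd t) hP x
      rw [hfix, ← qf_sub] at h1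
      have h2 := mul_le_mul_of_nonneg_left (hW x)
        (show 0 ≤ ‖P₀ - Pbar‖ * ρ ^ t by positivity)
      calc _ ≤ _ := h1
        _ ≤ _ := ih _
        _ ≤ _ := h2
        _ = _ := by ring
  refine tendsto_of_tendsto_qf (fun t => transpose_of_posSemidef (hpsd t)) hPt fun x => ?_
  have hpow : Tendsto (fun t : ℕ => qf Pbar x + ‖P₀ - Pbar‖ * ρ ^ t * qf W x) atTop
      (𝓝 (qf Pbar x)) := by
    have h1 := (((tendsto_pow_atTop_nhds_zero_of_lt_one hρ0.le hρ1).const_mul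
      ‖P₀ - Pbar‖).mul_const (qf W x)).const_add (qf Pbar x)
    simpa using h1
  refine tendsto_of_tendsto_of_tendsto_of_le_of_le
    (((continuous_qf x).tendsto Pbar).comp hzero) hpow (fun t => ?_) (fun t => ?_)
  · refine qf_riccati_iterate_mono A B C hD Matrix.PosSemidef.zero hP₀ (fun y => ?_) t x
    rw [qf_zero]
    exact qf_nonneg hP₀ y
  · have h1 := hup t x
    rw [qf_sub] at h1
    dsimp only
    linarith

end Lyapunov

/-! ### Orthogonal diagonalization -/

section Spectral

variable {n : ℕ}

/-- The matrix `V diag(d) Vᵀ`. -/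
noncomputable def conjDiag (V : Matrix (Fin n) (Fin n) ℝ) (d : Fin n → ℝ) :
    Matrix (Fin n) (Fin n) ℝ :=
  V * diagonal d * Vᵀ

theorem exists_conjDiag {P : Matrix (Fin n) (Fin n) ℝ} (hP : P.PosSemidef) :
    ∃ (V : Matrix (Fin n) (Fin n) ℝ) (v : Fin n → ℝ), Vᵀ * V = 1 ∧ (∀ i, 0 ≤ v i) ∧
      P = conjDiag V v ∧ spectrum ℝ P = Set.range v := by
  have hM := hP.isHermitian
  refine ⟨hM.eigenvectorUnitary, hM.eigenvalues, ?_, hP.eigenvalues_nonneg, ?_,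
    hM.spectrum_real_eq_range_eigenvalues⟩
  · have h := Unitary.coe_star_mul_self hM.eigenvectorUnitary
    rwa [Matrix.star_eq_conjTranspose, Matrix.conjTranspose_eq_transpose_of_trivial] at h
  · have h := hM.spectral_theorem
    rw [Unitary.conjStarAlgAut_apply, Matrix.star_eq_conjTranspose,
      Matrix.conjTranspose_eq_transpose_of_trivial] at h
    exact h

variable {V : Matrix (Fin n) (Fin n) ℝ} (hV : Vᵀ * V = 1)

theorem transpose_conjDiag (d : Fin n → ℝ) : (conjDiag V d)ᵀ = conjDiag V d := by
  simp [conjDiag, Matrix.transpose_mul, Matrix.mul_assoc]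

theorem conjDiag_sub (d e : Fin n → ℝ) :
    conjDiag V d - conjDiag V e = conjDiag V (fun i => d i - e i) := by
  rw [conjDiag, conjDiag, conjDiag, ← Matrix.sub_mul, ← Matrix.mul_sub, Matrix.diagonal_sub]

theorem smul_conjDiag (a : ℝ) (d : Fin n → ℝ) :
    a • conjDiag V d = conjDiag V (fun i => a * d i) := by
  have : diagonal (fun i => a * d i) = a • diagonal d := by
    rw [← Matrix.diagonal_smul]
    rfl
  rw [conjDiag, conjDiag, this, Matrix.mul_smul, Matrix.smul_mul]

theorem qf_conjDiag (d : Fin n → ℝ) (x : Fin n → ℝ) :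
    qf (conjDiag V d) x = ∑ i, d i * (Vᵀ *ᵥ x) i ^ 2 := by
  rw [conjDiag, qf_conj]
  simp only [qf, dotProduct, Matrix.mulVec_diagonal]
  exact Finset.sum_congr rfl fun i _ => by ring

theorem qf_conjDiag_mono {d e : Fin n → ℝ} (h : ∀ i, d i ≤ e i) (x : Fin n → ℝ) :
    qf (conjDiag V d) x ≤ qf (conjDiag V e) x := by
  rw [qf_conjDiag, qf_conjDiag]
  exact Finset.sum_le_sum fun i _ => mul_le_mul_of_nonneg_right (h i) (sq_nonneg _)

include hV

theorem conjDiag_one : conjDiag V (fun _ => 1) = 1 := by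
  rw [conjDiag, Matrix.diagonal_one, Matrix.mul_one]
  exact _root_.mul_eq_one_comm.1 hV

theorem conjDiag_mul (d e : Fin n → ℝ) :
    conjDiag V d * conjDiag V e = conjDiag V (fun i => d i * e i) := by
  calc V * diagonal d * Vᵀ * (V * diagonal e * Vᵀ)
      = V * diagonal d * (Vᵀ * V) * diagonal e * Vᵀ := by simp only [Matrix.mul_assoc]
    _ = V * (diagonal d * diagonal e) * Vᵀ := by
        rw [hV, Matrix.mul_one]; simp only [Matrix.mul_assoc]
    _ = conjDiag V (fun i => d i * e i) := by rw [Matrix.diagonal_mul_diagonal, conjDiag]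

theorem posDef_conjDiag_iff {d : Fin n → ℝ} : (conjDiag V d).PosDef ↔ ∀ i, 0 < d i := by
  have hV' : V * Vᵀ = 1 := _root_.mul_eq_one_comm.1 hV
  rw [posDef_iff_qf]
  constructor
  · rintro ⟨-, h⟩ i
    have hi := h (V *ᵥ Pi.single i 1) fun h0 => by
      have h1 := congrArg (Vᵀ *ᵥ ·) h0
      simp only [Matrix.mulVec_mulVec, hV, Matrix.one_mulVec, Matrix.mulVec_zero] at h1
      simpa using congrFun h1 i
    rw [qf_conjDiag, Matrix.mulVec_mulVec, hV, Matrix.one_mulVec] at hi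
    simpa [Pi.single_apply] using hi
  · refine fun h => ⟨transpose_conjDiag d, fun x hx => ?_⟩
    rw [qf_conjDiag]
    have hne : Vᵀ *ᵥ x ≠ 0 := fun h0 => hx <| by
      have h1 := congrArg (V *ᵥ ·) h0
      simpa only [Matrix.mulVec_mulVec, hV', Matrix.one_mulVec, Matrix.mulVec_zero] using h1
    obtain ⟨i, hi⟩ := Function.ne_iff.1 hne
    exact Finset.sum_pos' (fun j _ => mul_nonneg (h j).le (sq_nonneg _))
      ⟨i, Finset.mem_univ i, mul_pos (h i) (by positivity [show (Vᵀ *ᵥ x) i ≠ 0 from hi])⟩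

theorem inv_conjDiag {d : Fin n → ℝ} (hd : ∀ i, d i ≠ 0) :
    (conjDiag V d)⁻¹ = conjDiag V (fun i => (d i)⁻¹) := by
  refine Matrix.inv_eq_right_inv ?_
  rw [conjDiag_mul hV, ← conjDiag_one hV]
  congr 1
  funext i
  exact mul_inv_cancel₀ (hd i)

theorem charpoly_conjDiag (d : Fin n → ℝ) :
    (conjDiag V d).charpoly = ∏ i, (Polynomial.X - Polynomial.C (d i)) := by
  rw [conjDiag, Matrix.mul_assoc, Matrix.charpoly_mul_comm, Matrix.mul_assoc, hV, Matrix.mul_one,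
    Matrix.charpoly_diagonal]

theorem det_conjDiag (d : Fin n → ℝ) : (conjDiag V d).det = ∏ i, d i := by
  rw [conjDiag, Matrix.mul_assoc, Matrix.det_mul_comm, Matrix.mul_assoc, hV, Matrix.mul_one,
    Matrix.det_diagonal]

theorem trace_conjDiag (d : Fin n → ℝ) : (conjDiag V d).trace = ∑ i, d i := by
  rw [conjDiag, Matrix.mul_assoc, Matrix.trace_mul_comm, Matrix.mul_assoc, hV, Matrix.mul_one,
    Matrix.trace_diagonal]

theorem rank_conjDiag (d : Fin n → ℝ) :
    (conjDiag V d).rank = (Finset.univ.filter fun i => d i ≠ 0).card := by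
  have hu : IsUnit V.det := (Matrix.isUnit_iff_isUnit_det _).1 (IsUnit.of_mul_eq_one_right _ hV)
  have hu' : IsUnit Vᵀ.det := by rwa [Matrix.det_transpose]
  rw [conjDiag, Matrix.rank_mul_eq_left_of_isUnit_det _ _ hu',
    Matrix.rank_mul_eq_right_of_isUnit_det _ _ hu, Matrix.rank_diagonal, Fintype.card_subtype]

theorem pdet_conjDiag (d : Fin n → ℝ) :
    pdet (conjDiag V d) = ∏ i ∈ Finset.univ.filter (fun i => d i ≠ 0), d i := by
  have h : (∏ i, (Polynomial.X - Polynomial.C (d i))).roots = Finset.univ.val.map d := by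
    rw [← Polynomial.roots_multiset_prod_X_sub_C (Finset.univ.val.map d), Multiset.map_map]
    rfl
  rw [pdet, charpoly_conjDiag hV, h, Multiset.filter_map]
  rfl

theorem pinv_conjDiag (d : Fin n → ℝ) :
    pinv (conjDiag V d) = conjDiag V (fun i => (d i)⁻¹) := by
  have hh : (conjDiag V d).IsHermitian := by
    rw [Matrix.IsHermitian, Matrix.conjTranspose_eq_transpose_of_trivial, transpose_conjDiag]
  refine (isPseudoInverse_pinv hh).unique ⟨?_, ?_, ?_, ?_⟩
  · rw [conjDiag_mul hV, conjDiag_mul hV]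
    simp only [mul_inv_mul_cancel]
  · rw [conjDiag_mul hV, conjDiag_mul hV]
    congr 1
    funext i
    by_cases hi : d i = 0 <;> simp [hi]
  · rw [conjDiag_mul hV, transpose_conjDiag]
  · rw [conjDiag_mul hV, transpose_conjDiag]

omit hV in
theorem imageProj_eq {M N : Matrix (Fin n) (Fin n) ℝ} (hE : (M * N)ᵀ = M * N)
    (h : M * N * M = M) : imageProj M = M * N := by
  rw [imageProj, StarAlgEquiv.symm_apply_eq]
  ext1 x
  refine Submodule.eq_starProjection_of_mem_of_inner_eq_zero ?_ ?_
  · refine ⟨WithLp.toLp 2 (N *ᵥ x.ofLp), ?_⟩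
    rw [Matrix.toLpLin_toLp, Matrix.toLin'_apply, Matrix.mulVec_mulVec]
    rfl
  · rintro _ ⟨y, rfl⟩
    rw [inner_sub_left, sub_eq_zero, EuclideanSpace.inner_eq_star_dotProduct,
      EuclideanSpace.inner_eq_star_dotProduct]
    simp only [star_trivial, Matrix.ofLp_toEuclideanCLM, Matrix.ofLp_toLpLin, Matrix.toLin'_apply]
    have h2 : Mᵀ *ᵥ ((M * N) *ᵥ x.ofLp) = Mᵀ *ᵥ x.ofLp := by
      rw [Matrix.mulVec_mulVec, ← hE, ← Matrix.transpose_mul, h]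
    rw [← Matrix.vecMul_transpose M y.ofLp, ← Matrix.dotProduct_mulVec, ← Matrix.dotProduct_mulVec,
      h2]

end Spectral

/-! ### The distorted covariance and the risk sensitivity parameter -/

section Distortion

variable {n : ℕ}

/-- Twice the relative entropy between centred Gaussians with covariances `P (1 - S)⁻¹` and `P`, for
`S = θ P`. It makes sense without any rank assumption on `P`. -/
noncomputable def divergence (S : Matrix (Fin n) (Fin n) ℝ) : ℝ :=
  Real.log (1 - S).det + (S * (1 - S)⁻¹).trace

theorem log_add_inv_sub_one_nonneg {x : ℝ} (hx : 0 < x) : 0 ≤ Real.log x + x⁻¹ - 1 := by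
  have := Real.log_le_sub_one_of_pos (inv_pos.2 hx)
  rw [Real.log_inv] at this
  linarith

section ConjDiag

variable {V : Matrix (Fin n) (Fin n) ℝ} (hV : Vᵀ * V = 1)

include hV

theorem one_sub_smul_conjDiag (θ : ℝ) (v : Fin n → ℝ) :
    1 - θ • conjDiag V v = conjDiag V (fun i => 1 - θ * v i) := by
  rw [smul_conjDiag, ← conjDiag_one hV, conjDiag_sub]

theorem imageProj_conjDiag (v : Fin n → ℝ) :
    imageProj (conjDiag V v) = conjDiag V (fun i => v i * (v i)⁻¹) := by
  rw [← conjDiag_mul hV]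
  refine imageProj_eq ?_ ?_
  · rw [conjDiag_mul hV, transpose_conjDiag]
  · rw [conjDiag_mul hV, conjDiag_mul hV]
    simp only [mul_inv_mul_cancel]

theorem distort_conjDiag (θ : ℝ) (v : Fin n → ℝ) :
    distort (conjDiag V v) θ = conjDiag V (fun i => v i * (1 - θ * v i)⁻¹) := by
  rw [distort, pinv_conjDiag hV, imageProj_conjDiag hV, smul_conjDiag, conjDiag_sub,
    pinv_conjDiag hV]
  congr 1
  funext i
  by_cases hi : v i = 0
  · simp [hi]
  · rw [mul_inv_cancel₀ hi, mul_one]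
    have : (v i)⁻¹ - θ = (v i)⁻¹ * (1 - θ * v i) := by field_simp
    rw [this, mul_inv, inv_inv]

theorem divergence_conjDiag {θ : ℝ} {v : Fin n → ℝ} (h : ∀ i, 0 < 1 - θ * v i) :
    divergence (θ • conjDiag V v)
      = ∑ i, (Real.log (1 - θ * v i) + (1 - θ * v i)⁻¹ - 1) := by
  rw [divergence, one_sub_smul_conjDiag hV, inv_conjDiag hV fun i => (h i).ne', smul_conjDiag,
    conjDiag_mul hV, det_conjDiag hV, trace_conjDiag hV, Real.log_prod fun i _ => (h i).ne',
    ← Finset.sum_add_distrib]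
  refine Finset.sum_congr rfl fun i _ => ?_
  have := (h i).ne'
  field_simp
  ring

theorem gam_conjDiag {lam : ℝ} {v : Fin n → ℝ} (h : ∀ i, 0 < 1 - lam⁻¹ * v i) :
    gam (conjDiag V v) lam = divergence (lam⁻¹ • conjDiag V v) / 2 := by
  rw [divergence_conjDiag hV h, gam, distort_conjDiag hV, pinv_conjDiag hV, conjDiag_mul hV,
    trace_conjDiag hV, rank_conjDiag hV, pdet_conjDiag hV, pdet_conjDiag hV]
  have hne : ∀ i, v i * (1 - lam⁻¹ * v i)⁻¹ ≠ 0 ↔ v i ≠ 0 := fun i => by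
    simp [(h i).ne']
  simp only [hne]
  rw [Real.log_prod fun i hi => (Finset.mem_filter.1 hi).2,
    Real.log_prod fun i hi => mul_ne_zero (Finset.mem_filter.1 hi).2 (inv_ne_zero (h i).ne'),
    Finset.card_eq_sum_ones, Nat.cast_sum, Finset.sum_filter, Finset.sum_filter, Finset.sum_filter,
    ← Finset.sum_sub_distrib, ← Finset.sum_sub_distrib, ← Finset.sum_add_distrib, one_div,
    inv_mul_eq_div]
  congr 1
  refine Finset.sum_congr rfl fun i _ => ?_
  by_cases hi : v i = 0
  · simp [hi]
  · simp only [ne_eq, hi, not_false_eq_true, if_true]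
    rw [Real.log_mul hi (inv_ne_zero (h i).ne'), Real.log_inv, ← mul_assoc, inv_mul_cancel₀ hi]
    push_cast
    ring

end ConjDiag

/-- The multiplier condition without pseudo inverses: it is stated through `1 - lam⁻¹ P`, which is
insensitive to the rank of `P`. -/
theorem isMultiplier_iff {P : Matrix (Fin n) (Fin n) ℝ} (hP : P.PosSemidef) (c lam : ℝ) :
    IsMultiplier c P lam ↔
      0 < lam ∧ (1 - lam⁻¹ • P).PosDef ∧ divergence (lam⁻¹ • P) = 2 * c := by
  obtain ⟨V, v, hV, -, rfl, hspec⟩ := exists_conjDiag hP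
  rw [IsMultiplier, hspec, one_sub_smul_conjDiag hV, posDef_conjDiag_iff hV]
  refine and_congr_right fun hlam => ?_
  have h1 : (∀ σ ∈ Set.range v, σ < lam) ↔ ∀ i, 0 < 1 - lam⁻¹ * v i := by
    rw [Set.forall_mem_range]
    refine forall_congr' fun i => ?_
    rw [sub_pos, inv_mul_lt_iff₀ hlam, mul_one]
  rw [h1]
  refine and_congr_right fun h => ?_
  rw [gam_conjDiag hV h]
  constructor <;> intro h <;> linarith

/-- Existence of the multiplier, by the intermediate value theorem: the divergence vanishes for
`θ = 0` and is unbounded as `θ` tends to the inverse of the largest eigenvalue. -/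
theorem exists_isMultiplier {P : Matrix (Fin n) (Fin n) ℝ} (hP : P.PosSemidef) (h0 : P ≠ 0) {c : ℝ}
    (hc : 0 < c) : ∃ lam, IsMultiplier c P lam := by
  simp only [isMultiplier_iff hP]
  obtain ⟨V, v, hV, hv, rfl, -⟩ := exists_conjDiag hP
  obtain ⟨j, hj⟩ : ∃ j, v j ≠ 0 := by
    by_contra! h
    apply h0
    have : v = fun _ => 0 := funext h
    rw [this, conjDiag, Matrix.diagonal_zero, Matrix.mul_zero, Matrix.zero_mul]
  obtain ⟨k, -, hk⟩ := Finset.exists_max_image Finset.univ v ⟨j, Finset.mem_univ j⟩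
  have hvk : 0 < v k := lt_of_lt_of_le (lt_of_le_of_ne (hv j) hj.symm) (hk j (Finset.mem_univ j))
  -- `y = 1 / (1 - θ v k)` is chosen so that `y - 1 - log y ≥ (√y - 1) ^ 2 = 2 c`
  set s := √(2 * c) with hs
  have hs0 : 0 ≤ s := Real.sqrt_nonneg _
  have hs2 : s ^ 2 = 2 * c := Real.sq_sqrt (by positivity)
  set θ₁ := (1 - ((1 + s) ^ 2)⁻¹) / v k with hθ₁
  have hy0 : 0 < ((1 + s) ^ 2)⁻¹ := by positivity
  have hy1 : ((1 + s) ^ 2)⁻¹ ≤ 1 := inv_le_one_of_one_le₀ (by nlinarith)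
  have hθ₁0 : 0 ≤ θ₁ := div_nonneg (by linarith) hvk.le
  have hθ₁k : θ₁ * v k = 1 - ((1 + s) ^ 2)⁻¹ := by
    rw [hθ₁]
    field_simp
  have hpos : ∀ θ ∈ Set.Icc 0 θ₁, ∀ i, 0 < 1 - θ * v i := fun θ hθ i => by
    have : θ * v i ≤ θ₁ * v k := mul_le_mul hθ.2 (hk i (Finset.mem_univ i)) (hv i) hθ₁0
    linarith
  let f : ℝ → ℝ := fun θ => ∑ i, (Real.log (1 - θ * v i) + (1 - θ * v i)⁻¹ - 1)
  have hf : ContinuousOn f (Set.Icc 0 θ₁) := by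
    refine continuousOn_finsetSum _ fun i _ => ?_
    have hcont : ContinuousOn (fun θ : ℝ => 1 - θ * v i) (Set.Icc 0 θ₁) := by fun_prop
    exact ((hcont.log fun θ hθ => (hpos θ hθ i).ne').add
      (hcont.inv₀ fun θ hθ => (hpos θ hθ i).ne')).sub continuousOn_const
  have hf0 : f 0 = 0 := by simp [f]
  have hf1 : 2 * c ≤ f θ₁ := by
    refine le_trans ?_ (Finset.single_le_sum (f := fun i =>
      Real.log (1 - θ₁ * v i) + (1 - θ₁ * v i)⁻¹ - 1)
      (fun i _ => log_add_inv_sub_one_nonneg (hpos θ₁ ⟨hθ₁0, le_rfl⟩ i)) (Finset.mem_univ k))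
    rw [hθ₁k, sub_sub_cancel, inv_inv, Real.log_inv, Real.log_pow]
    have := Real.log_le_sub_one_of_pos (show 0 < 1 + s by linarith)
    push_cast
    nlinarith
  obtain ⟨θ, hθ, hfθ⟩ := intermediate_value_Icc hθ₁0 hf
    (show 2 * c ∈ Set.Icc (f 0) (f θ₁) from ⟨by rw [hf0]; positivity, hf1⟩)
  have hθ0 : 0 < θ := lt_of_le_of_ne hθ.1 fun h => by
    rw [← h, hf0] at hfθ
    linarith
  refine ⟨θ⁻¹, inv_pos.2 hθ0, ?_, ?_⟩
  · rw [inv_inv, one_sub_smul_conjDiag hV, posDef_conjDiag_iff hV]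
    exact hpos θ hθ
  · rw [inv_inv, divergence_conjDiag hV (hpos θ hθ)]
    exact hfθ

theorem riskParam_spec {P : Matrix (Fin n) (Fin n) ℝ} (hP : P.PosSemidef) (h0 : P ≠ 0) {c : ℝ}
    (hc : 0 < c) : 0 < riskParam c P ∧ (1 - riskParam c P • P).PosDef ∧
      divergence (riskParam c P • P) = 2 * c := by
  have h := exists_isMultiplier hP h0 hc
  rw [riskParam, dif_pos h]
  obtain ⟨h1, h2, h3⟩ := (isMultiplier_iff hP c _).1 h.choose_spec
  exact ⟨inv_pos.2 h1, h2, h3⟩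

theorem distort_eq {P : Matrix (Fin n) (Fin n) ℝ} (hP : P.PosSemidef) {θ : ℝ}
    (h : (1 - θ • P).PosDef) : distort P θ = P * (1 - θ • P)⁻¹ := by
  obtain ⟨V, v, hV, -, rfl, -⟩ := exists_conjDiag hP
  rw [one_sub_smul_conjDiag hV] at h ⊢
  rw [inv_conjDiag hV fun i => ((posDef_conjDiag_iff hV).1 h i).ne', conjDiag_mul hV,
    distort_conjDiag hV]

theorem distort_zero (θ : ℝ) : distort (0 : Matrix (Fin n) (Fin n) ℝ) θ = 0 := by
  have h : (1 - θ • (0 : Matrix (Fin n) (Fin n) ℝ)).PosDef := by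
    rw [smul_zero, sub_zero]
    exact Matrix.PosDef.one
  rw [distort_eq Matrix.PosSemidef.zero h, Matrix.zero_mul]

theorem posSemidef_distort {P : Matrix (Fin n) (Fin n) ℝ} (hP : P.PosSemidef) {θ : ℝ}
    (h : (1 - θ • P).PosDef) : (distort P θ).PosSemidef := by
  obtain ⟨V, v, hV, hv, rfl, -⟩ := exists_conjDiag hP
  rw [one_sub_smul_conjDiag hV, posDef_conjDiag_iff hV] at h
  rw [distort_conjDiag hV]
  refine posSemidef_iff_qf.2 ⟨transpose_conjDiag _, fun x => ?_⟩
  rw [qf_conjDiag]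
  exact Finset.sum_nonneg fun i _ =>
    mul_nonneg (mul_nonneg (hv i) (inv_nonneg.2 (h i).le)) (sq_nonneg _)

theorem posSemidef_distort_riskParam {P : Matrix (Fin n) (Fin n) ℝ} (hP : P.PosSemidef) {c : ℝ}
    (hc : 0 < c) : (distort P (riskParam c P)).PosSemidef := by
  by_cases h0 : P = 0
  · rw [h0, distort_zero]
    exact Matrix.PosSemidef.zero
  · exact posSemidef_distort hP (riskParam_spec hP h0 hc).2.1

/-- A small tolerance `c` keeps `1 - θ P` above `κ⁻¹`, uniformly in `P`: every eigenvalue `y` of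
`(1 - θ P)⁻¹` satisfies `y - 1 - log y ≤ 2 c`. The bounds on the distorted covariance
also hold for `P = 0`. -/
theorem riskParam_bounds {P : Matrix (Fin n) (Fin n) ℝ} (hP : P.PosSemidef) {c κ : ℝ} (hc : 0 < c)
    (hκ : 1 ≤ κ) (hcκ : 2 * c < κ - 1 - Real.log κ) :
    (P ≠ 0 → ∀ x, x ⬝ᵥ x ≤ qf (1 - riskParam c P • P)⁻¹ x ∧
      qf (1 - riskParam c P • P)⁻¹ x ≤ κ * (x ⬝ᵥ x) ∧
      riskParam c P * qf P x ≤ (κ - 1) * (x ⬝ᵥ x)) ∧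
    ∀ x, qf P x ≤ qf (distort P (riskParam c P)) x ∧
      qf (distort P (riskParam c P)) x ≤ κ * qf P x := by
  by_cases h0 : P = 0
  · subst h0
    rw [distort_zero]
    refine ⟨fun h => absurd rfl h, fun x => ?_⟩
    simp [qf_zero]
  obtain ⟨hθ, hpd, hdiv⟩ := riskParam_spec hP h0 hc
  set θ := riskParam c P with hθdef
  clear_value θ
  obtain ⟨V, v, hV, hv, rfl, -⟩ := exists_conjDiag hP
  rw [one_sub_smul_conjDiag hV, posDef_conjDiag_iff hV] at hpd
  rw [divergence_conjDiag hV hpd] at hdiv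
  have hub : ∀ i, (1 - θ * v i)⁻¹ ≤ κ := fun i => by
    have h1 : Real.log (1 - θ * v i) + (1 - θ * v i)⁻¹ - 1 ≤ 2 * c := by
      rw [← hdiv]
      exact Finset.single_le_sum (f := fun i => Real.log (1 - θ * v i) + (1 - θ * v i)⁻¹ - 1)
        (fun i _ => log_add_inv_sub_one_nonneg (hpd i)) (Finset.mem_univ i)
    by_contra! hlt
    set y := (1 - θ * v i)⁻¹ with hy
    have hlog : Real.log (1 - θ * v i) = -Real.log y := by rw [hy, Real.log_inv, neg_neg]
    have hκ0 : 0 < κ := by linarith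
    have hy0 : 0 < y := by linarith
    have h2 := Real.log_le_sub_one_of_pos (div_pos hy0 hκ0)
    rw [Real.log_div hy0.ne' hκ0.ne'] at h2
    have h3 : y / κ - 1 ≤ y - κ := by
      rw [div_sub_one hκ0.ne', div_le_iff₀ hκ0]
      nlinarith
    rw [hlog] at h1
    linarith
  have hlb : ∀ i, 1 ≤ (1 - θ * v i)⁻¹ := fun i =>
    (one_le_inv₀ (hpd i)).2 (by linarith [mul_nonneg hθ.le (hv i)])
  have hone : ∀ x : Fin n → ℝ, qf (conjDiag V fun _ => 1) x = x ⬝ᵥ x := fun x => by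
    rw [conjDiag_one hV, qf_one]
  refine ⟨fun _ x => ?_, fun x => ?_⟩
  · rw [one_sub_smul_conjDiag hV, inv_conjDiag hV fun i => (hpd i).ne', ← hone, ← qf_smul,
      ← qf_smul, ← qf_smul, smul_conjDiag, smul_conjDiag, smul_conjDiag]
    refine ⟨qf_conjDiag_mono hlb x, qf_conjDiag_mono (fun i => ?_) x,
      qf_conjDiag_mono (fun i => ?_) x⟩
    · rw [mul_one]
      exact hub i
    · have h1 := hub i
      have h2 := hpd i
      rw [inv_le_comm₀ h2 (by linarith)] at h1
      have h3 : 1 - κ⁻¹ ≤ κ - 1 := by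
        have hκ0 : 0 < κ := by linarith
        have : κ * κ⁻¹ = 1 := mul_inv_cancel₀ hκ0.ne'
        nlinarith [sq_nonneg (κ - 1), inv_pos.2 hκ0]
      linarith
  · rw [distort_conjDiag hV, ← qf_smul, smul_conjDiag]
    refine ⟨qf_conjDiag_mono (fun i => ?_) x, qf_conjDiag_mono (fun i => ?_) x⟩
    · exact le_mul_of_one_le_right (hv i) (hlb i)
    · rw [mul_comm]
      exact mul_le_mul_of_nonneg_right (hub i) (hv i)

end Distortion

/-! ### Lipschitz dependence of the distortion on the covariance -/

section Lipschitz

variable {n : ℕ}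

theorem exists_symm_mul_self_eq {P : Matrix (Fin n) (Fin n) ℝ} (hP : P.PosSemidef) :
    ∃ Z : Matrix (Fin n) (Fin n) ℝ, Zᵀ = Z ∧ P = Z * Z := by
  obtain ⟨V, v, hV, hv, rfl, -⟩ := exists_conjDiag hP
  refine ⟨conjDiag V fun i => √(v i), transpose_conjDiag _, ?_⟩
  rw [conjDiag_mul hV]
  simp only [Real.mul_self_sqrt (hv _)]

theorem trace_mul_nonneg {X Y : Matrix (Fin n) (Fin n) ℝ} (hX : X.PosSemidef)
    (hY : Y.PosSemidef) : 0 ≤ (X * Y).trace := by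
  obtain ⟨Z, hZ, rfl⟩ := exists_symm_mul_self_eq hY
  rw [← Matrix.mul_assoc, Matrix.trace_mul_comm, ← Matrix.mul_assoc]
  have h := hX.mul_mul_conjTranspose_same Z
  rw [Matrix.conjTranspose_eq_transpose_of_trivial, hZ] at h
  exact h.trace_nonneg

/-- Concavity of `log det`. -/
theorem log_det_sub_log_det_le {M M' : Matrix (Fin n) (Fin n) ℝ} (hM : M.PosDef)
    (hM' : M'.PosDef) : Real.log M'.det - Real.log M.det ≤ (M⁻¹ * M').trace - n := by
  obtain ⟨Z, hZ, hZM⟩ := exists_symm_mul_self_eq hM.inv.posSemidef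
  have hZu : IsUnit Z := by
    have h := hM.inv.isUnit
    rw [hZM, Matrix.isUnit_iff_isUnit_det, Matrix.det_mul] at h
    exact (Matrix.isUnit_iff_isUnit_det _).2 (isUnit_of_mul_isUnit_left h)
  have hpd : (Z * M' * Z).PosDef := by
    have h := (Matrix.IsUnit.posDef_star_right_conjugate_iff hZu (x := M')).2 hM'
    rwa [Matrix.star_eq_conjTranspose, Matrix.conjTranspose_eq_transpose_of_trivial, hZ] at h
  have hdet : (Z * M' * Z).det = M.det⁻¹ * M'.det := by
    have h : M⁻¹.det = M.det⁻¹ := by rw [Matrix.det_nonsing_inv, Ring.inverse_eq_inv']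
    rw [← h, hZM, Matrix.det_mul, Matrix.det_mul, Matrix.det_mul]
    ring
  have htr : (Z * M' * Z).trace = (M⁻¹ * M').trace := by
    rw [hZM, Matrix.trace_mul_comm, ← Matrix.mul_assoc]
  have hlog : Real.log (Z * M' * Z).det = Real.log M'.det - Real.log M.det := by
    rw [hdet, Real.log_mul (inv_ne_zero hM.det_pos.ne') hM'.det_pos.ne', Real.log_inv]
    ring
  rw [← hlog, ← htr]
  obtain ⟨V, w, hV, -, hw, -⟩ := exists_conjDiag hpd.posSemidef
  rw [hw] at hpd ⊢
  have hpos := (posDef_conjDiag_iff hV).1 hpd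
  rw [det_conjDiag hV, trace_conjDiag hV, Real.log_prod fun i _ => (hpos i).ne']
  have h1 : ∑ i, Real.log (w i) ≤ ∑ i, (w i - 1) :=
    Finset.sum_le_sum fun i _ => Real.log_le_sub_one_of_pos (hpos i)
  simpa using h1

/-- A first-order lower bound for the divergence, a consequence of the concavity of `log det`. -/
theorem trace_le_divergence_sub {S S' : Matrix (Fin n) (Fin n) ℝ} (h : (1 - S).PosDef)
    (h' : (1 - S').PosDef) :
    ((1 - S')⁻¹ * S * (1 - S)⁻¹ * (S' - S)).trace ≤ divergence S' - divergence S := by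
  have hu : IsUnit (1 - S).det := (Matrix.isUnit_iff_isUnit_det _).1 h.isUnit
  have hu' : IsUnit (1 - S').det := (Matrix.isUnit_iff_isUnit_det _).1 h'.isUnit
  have hlog := log_det_sub_log_det_le h' h
  have htr : ∀ X : Matrix (Fin n) (Fin n) ℝ, IsUnit (1 - X).det →
      (X * (1 - X)⁻¹).trace = (1 - X)⁻¹.trace - n := fun X hX => by
    have e : X * (1 - X)⁻¹ = (1 - X)⁻¹ - 1 := by
      rw [eq_sub_iff_add_eq, ← eq_sub_iff_add_eq', ← Matrix.one_mul (1 - X)⁻¹, ← Matrix.mul_assoc,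
        Matrix.mul_one, ← Matrix.sub_mul, Matrix.mul_nonsing_inv _ hX]
    rw [e, Matrix.trace_sub, Matrix.trace_one, Fintype.card_fin]
  rw [divergence, divergence, htr S hu, htr S' hu']
  set M := 1 - S with hM
  set M' := 1 - S' with hM'
  have hS : S = 1 - M := by rw [hM, sub_sub_cancel]
  have hS' : S' - S = M - M' := by rw [hM, hM']; abel
  clear_value M M'
  have e : M'⁻¹ * S * M⁻¹ * (S' - S) = M'⁻¹ - M'⁻¹ * (M⁻¹ * M') - M'⁻¹ * M + 1 := by
    rw [hS', hS]
    have e1 : M'⁻¹ * (1 - M) * M⁻¹ = M'⁻¹ * M⁻¹ - M'⁻¹ := by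
      rw [Matrix.mul_assoc, Matrix.sub_mul, Matrix.one_mul, Matrix.mul_nonsing_inv _ hu,
        Matrix.mul_sub, Matrix.mul_one]
    rw [e1, Matrix.sub_mul, Matrix.mul_sub, Matrix.mul_sub, Matrix.mul_assoc _ M⁻¹ M,
      Matrix.nonsing_inv_mul _ hu, Matrix.nonsing_inv_mul _ hu', Matrix.mul_one, Matrix.mul_assoc]
    abel
  have e2 : (M'⁻¹ * (M⁻¹ * M')).trace = M⁻¹.trace := by
    rw [Matrix.trace_mul_comm, Matrix.mul_assoc, Matrix.mul_nonsing_inv _ hu', Matrix.mul_one]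
  rw [e, Matrix.trace_add, Matrix.trace_sub, Matrix.trace_sub, e2, Matrix.trace_one,
    Fintype.card_fin]
  linarith

theorem abs_entry_le_norm (X : Matrix (Fin n) (Fin n) ℝ) (i j : Fin n) : |X i j| ≤ ‖X‖ := by
  rw [Matrix.linfty_opNorm_def]
  have h1 : ‖X i j‖₊ ≤ ∑ j, ‖X i j‖₊ :=
    Finset.single_le_sum (f := fun j => ‖X i j‖₊) (fun _ _ => zero_le) (Finset.mem_univ j)
  have h2 : (∑ j, ‖X i j‖₊) ≤ Finset.univ.sup fun i => ∑ j, ‖X i j‖₊ :=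
    Finset.le_sup (f := fun i => ∑ j, ‖X i j‖₊) (Finset.mem_univ i)
  exact NNReal.coe_le_coe.2 (h1.trans h2)

theorem trace_le_norm (X : Matrix (Fin n) (Fin n) ℝ) : X.trace ≤ n * ‖X‖ := by
  calc X.trace = ∑ i, X i i := rfl
    _ ≤ ∑ _i : Fin n, ‖X‖ :=
        Finset.sum_le_sum fun i _ => (le_abs_self _).trans (abs_entry_le_norm X i i)
    _ = n * ‖X‖ := by simp

theorem sq_entry_le_trace {P : Matrix (Fin n) (Fin n) ℝ} (hP : Pᵀ = P) (i : Fin n) :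
    P i i ^ 2 ≤ (P * P).trace := by
  have hsym : ∀ i j, P j i = P i j := fun i j => congrFun (congrFun hP i) j
  have h : (P * P).trace = ∑ j, ∑ k, P j k ^ 2 := by
    simp only [Matrix.trace, Matrix.diag, Matrix.mul_apply]
    exact Finset.sum_congr rfl fun j _ => Finset.sum_congr rfl fun k _ => by rw [hsym j k, sq]
  rw [h]
  refine (Finset.single_le_sum (f := fun k => P i k ^ 2) (fun _ _ => sq_nonneg _)
    (Finset.mem_univ i)).trans ?_
  exact Finset.single_le_sum (f := fun j => ∑ k, P j k ^ 2)
    (fun _ _ => Finset.sum_nonneg fun _ _ => sq_nonneg _) (Finset.mem_univ i)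

/-- Comparison of the risk sensitivity parameters `θ` of `P` and `θ'` of `P'`: both make the
divergence equal to `2 c`, and the divergence is steep in the direction of `P`. -/
theorem sub_mul_trace_le {P P' : Matrix (Fin n) (Fin n) ℝ} (hP : P.PosSemidef) {θ θ' : ℝ}
    (hθ : 0 < θ) (hle : θ ≤ θ') (h : (1 - θ • P).PosDef) (h' : (1 - θ' • P').PosDef)
    (hdiv : divergence (θ • P) = divergence (θ' • P'))
    (hlow : ∀ x, x ⬝ᵥ x ≤ qf (1 - θ • P)⁻¹ x) (hlow' : ∀ x, x ⬝ᵥ x ≤ qf (1 - θ' • P')⁻¹ x) :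
    (θ' - θ) * (P * P).trace
      ≤ θ' * ((1 - θ' • P')⁻¹ * P * (1 - θ • P)⁻¹ * (P - P')).trace := by
  have h1 := trace_le_divergence_sub h h'
  rw [hdiv, sub_self] at h1
  set N := (1 - θ • P)⁻¹ with hN
  set N' := (1 - θ' • P')⁻¹ with hN'
  have hNt : Nᵀ = N := transpose_of_posSemidef h.inv.posSemidef
  have hNt' : N'ᵀ = N' := transpose_of_posSemidef h'.inv.posSemidef
  have hPt := transpose_of_posSemidef hP
  have e : N' * (θ • P) * N * (θ' • P' - θ • P)
      = θ • ((θ' - θ) • (N' * P * N * P) - θ' • (N' * P * N * (P - P'))) := by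
    simp only [Matrix.mul_smul, Matrix.smul_mul, Matrix.mul_sub]
    module
  rw [e, Matrix.trace_smul, smul_eq_mul, Matrix.trace_sub, Matrix.trace_smul, Matrix.trace_smul,
    smul_eq_mul, smul_eq_mul] at h1
  have h2 : (θ' - θ) * (N' * P * N * P).trace ≤ θ' * (N' * P * N * (P - P')).trace := by
    by_contra! hlt
    exact absurd h1 (not_le.2 (mul_pos hθ (sub_pos.2 hlt)))
  refine le_trans (mul_le_mul_of_nonneg_left ?_ (sub_nonneg.2 hle)) h2
  have hsub : ∀ X : Matrix (Fin n) (Fin n) ℝ, Xᵀ = X → (∀ x, x ⬝ᵥ x ≤ qf X x) →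
      (X - 1).PosSemidef := fun X hX hx => posSemidef_iff_qf.2
    ⟨by rw [Matrix.transpose_sub, hX, Matrix.transpose_one], fun x => by
      rw [qf_sub, qf_one]
      linarith [hx x]⟩
  have hPNP : (P * N * P).PosSemidef := by
    have := h.inv.posSemidef.mul_mul_conjTranspose_same P
    rwa [Matrix.conjTranspose_eq_transpose_of_trivial, hPt] at this
  have h3 := trace_mul_nonneg (hsub N' hNt' hlow') hPNP
  have h4 := ((hsub N hNt hlow).mul_mul_conjTranspose_same P).trace_nonneg
  rw [Matrix.conjTranspose_eq_transpose_of_trivial, hPt, Matrix.mul_sub, Matrix.sub_mul,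
    Matrix.mul_one, Matrix.trace_sub] at h4
  rw [Matrix.sub_mul, Matrix.one_mul, Matrix.trace_sub] at h3
  simp only [← Matrix.mul_assoc] at h3
  linarith

theorem norm_mul₃_le (X Y Z : Matrix (Fin n) (Fin n) ℝ) {a b c : ℝ} (hX : ‖X‖ ≤ a)
    (hY : ‖Y‖ ≤ b) (hZ : ‖Z‖ ≤ c) : ‖X * Y * Z‖ ≤ a * b * c := by
  have ha : 0 ≤ a := (norm_nonneg X).trans hX
  have hb : 0 ≤ b := (norm_nonneg Y).trans hY
  calc ‖X * Y * Z‖ ≤ ‖X‖ * ‖Y‖ * ‖Z‖ :=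
        (norm_mul_le _ _).trans (mul_le_mul_of_nonneg_right (norm_mul_le _ _) (norm_nonneg _))
    _ ≤ a * b * c := by gcongr

/-- On bounded sets of covariances away from zero, the distortion differs from the identity by a map
whose Lipschitz constant is as small as desired, provided that the tolerance is small. -/
theorem exists_distort_lipschitz (i : Fin n) {b τ η : ℝ} (hb : 0 < b) (hτ : 0 < τ) (hη : 0 < η) :
    ∃ κ₀ : ℝ, 1 < κ₀ ∧ ∀ κ c : ℝ, 1 ≤ κ → κ ≤ κ₀ → 0 < c → 2 * c < κ - 1 - Real.log κ →
      ∀ P P' : Matrix (Fin n) (Fin n) ℝ, P.PosSemidef → P'.PosSemidef → ‖P‖ ≤ b → ‖P'‖ ≤ b →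
        τ ≤ P i i → τ ≤ P' i i →
        ‖distort P (riskParam c P) - distort P' (riskParam c P') - (P - P')‖ ≤ η * ‖P - P'‖ := by
  set L : ℝ := 2 * n * n + n + 16 * n ^ 5 * b ^ 3 / τ ^ 3 with hL
  have hL0 : 0 ≤ L := by positivity
  refine ⟨1 + min 1 (η / (L + 1)), by
    have : 0 < min 1 (η / (L + 1)) := by positivity
    linarith, fun κ c hκ hκ₀ hc hcκ => ?_⟩
  set e := κ - 1 with he
  have he0 : 0 ≤ e := by linarith
  have he1 : e ≤ 1 := by linarith [min_le_left 1 (η / (L + 1))]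
  have heη : e * L ≤ η := by
    have h1 : e ≤ η / (L + 1) := by linarith [min_le_right 1 (η / (L + 1))]
    rw [le_div_iff₀ (by positivity)] at h1
    nlinarith
  -- the bounds used for either argument
  have hone : ∀ P : Matrix (Fin n) (Fin n) ℝ, P.PosSemidef → τ ≤ P i i →
      P ≠ 0 ∧ riskParam c P ≤ e / τ ∧ ‖(1 - riskParam c P • P)⁻¹‖ ≤ 2 * n ∧
        ‖(1 - riskParam c P • P)⁻¹ - 1‖ ≤ n * e := by
    intro P hP hPi
    have hP0 : P ≠ 0 := by
      rintro rfl
      simp only [Matrix.zero_apply] at hPi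
      linarith
    obtain ⟨hθ, hpd, -⟩ := riskParam_spec hP hP0 hc
    have hbd := (riskParam_bounds hP hc hκ hcκ).1 hP0
    have hNt : ((1 - riskParam c P • P)⁻¹)ᵀ = (1 - riskParam c P • P)⁻¹ :=
      transpose_of_posSemidef hpd.inv.posSemidef
    refine ⟨hP0, ?_, ?_, ?_⟩
    · have h1 := (hbd (Pi.single i 1)).2.2
      rw [qf_single] at h1
      have h2 : (Pi.single i 1 : Fin n → ℝ) ⬝ᵥ Pi.single i 1 = 1 := by simp
      rw [h2, mul_one] at h1
      rw [le_div_iff₀ hτ]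
      exact (mul_le_mul_of_nonneg_left hPi hθ.le).trans h1
    · rw [mul_comm]
      refine norm_le_of_abs_qf_le hNt (by norm_num) fun x => ?_
      obtain ⟨h1, h2, -⟩ := hbd x
      have h3 := dot_self_nonneg x
      rw [abs_of_nonneg (h3.trans h1)]
      nlinarith
    · refine norm_le_of_abs_qf_le (by rw [Matrix.transpose_sub, hNt, Matrix.transpose_one]) he0
        fun x => ?_
      obtain ⟨h1, h2, -⟩ := hbd x
      rw [qf_sub, qf_one, abs_of_nonneg (by linarith)]
      linarith
  -- one-sided comparison of the two parameters
  have hdiff : ∀ P P' : Matrix (Fin n) (Fin n) ℝ, P.PosSemidef → P'.PosSemidef → ‖P‖ ≤ b →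
      τ ≤ P i i → τ ≤ P' i i → riskParam c P' - riskParam c P
        ≤ e * (4 * n ^ 3 * b / τ ^ 3) * ‖P - P'‖ := by
    intro P P' hP hP' hPb hPi hPi'
    rcases le_total (riskParam c P') (riskParam c P) with hle | hle
    · exact (sub_nonpos.2 hle).trans (by positivity)
    obtain ⟨hP0, -, hN, -⟩ := hone P hP hPi
    obtain ⟨hP0', hθ', hN', -⟩ := hone P' hP' hPi'
    obtain ⟨hθ, hpd, hdiv⟩ := riskParam_spec hP hP0 hc
    obtain ⟨hθ'0, hpd', hdiv'⟩ := riskParam_spec hP' hP0' hc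
    have h1 := sub_mul_trace_le hP hθ hle hpd hpd' (hdiv.trans hdiv'.symm)
      (fun x => ((riskParam_bounds hP hc hκ hcκ).1 hP0 x).1)
      (fun x => ((riskParam_bounds hP' hc hκ hcκ).1 hP0' x).1)
    have h2 : τ ^ 2 ≤ (P * P).trace :=
      (pow_le_pow_left₀ hτ.le hPi 2).trans (sq_entry_le_trace (transpose_of_posSemidef hP) i)
    have h3 : ((1 - riskParam c P' • P')⁻¹ * P * (1 - riskParam c P • P)⁻¹ * (P - P')).trace
        ≤ n * (2 * n * b * (2 * n) * ‖P - P'‖) := by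
      refine (trace_le_norm _).trans (mul_le_mul_of_nonneg_left ?_ (by positivity))
      exact (norm_mul_le _ _).trans
        (mul_le_mul_of_nonneg_right (norm_mul₃_le _ _ _ hN' hPb hN) (norm_nonneg _))
    have h4 : (riskParam c P' - riskParam c P) * τ ^ 2
        ≤ e / τ * (n * (2 * n * b * (2 * n) * ‖P - P'‖)) := by
      refine (mul_le_mul_of_nonneg_left h2 (sub_nonneg.2 hle)).trans (h1.trans ?_)
      refine (mul_le_mul_of_nonneg_left h3 hθ'0.le).trans ?_
      exact mul_le_mul_of_nonneg_right hθ' (by positivity)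
    rw [← le_div_iff₀ (by positivity)] at h4
    refine h4.trans (le_of_eq ?_)
    field_simp
    ring
  intro P P' hP hP' hPb hPb' hPi hPi'
  obtain ⟨hP0, -, hN, hN1⟩ := hone P hP hPi
  obtain ⟨hP0', -, hN', hN1'⟩ := hone P' hP' hPi'
  have hpd := (riskParam_spec hP hP0 hc).2.1
  have hpd' := (riskParam_spec hP' hP0' hc).2.1
  have habs : |riskParam c P - riskParam c P'| ≤ e * (4 * n ^ 3 * b / τ ^ 3) * ‖P - P'‖ := by
    rw [abs_le]
    have h1 := hdiff P P' hP hP' hPb hPi hPi'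
    have h2 := hdiff P' P hP' hP hPb' hPi' hPi
    rw [norm_sub_rev] at h2
    constructor <;> linarith
  have hTt' := transpose_of_posSemidef (posSemidef_distort_riskParam hP' hc)
  rw [distort_eq hP' hpd', Matrix.transpose_mul,
    transpose_of_posSemidef hpd'.inv.posSemidef, transpose_of_posSemidef hP'] at hTt'
  rw [distort_eq hP hpd, distort_eq hP' hpd', ← hTt']
  set θ := riskParam c P with hθ
  set θ' := riskParam c P' with hθ'
  have hu : IsUnit (1 - θ • P).det := (Matrix.isUnit_iff_isUnit_det _).1 hpd.isUnit
  have hu' : IsUnit (1 - θ' • P').det := (Matrix.isUnit_iff_isUnit_det _).1 hpd'.isUnit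
  -- resolvent identity
  have key : P * (1 - θ • P)⁻¹ - (1 - θ' • P')⁻¹ * P' - (P - P')
      = ((1 - θ' • P')⁻¹ - 1) * (P - P') * (1 - θ • P)⁻¹
        + (P - P') * ((1 - θ • P)⁻¹ - 1)
        + (θ - θ') • (((1 - θ' • P')⁻¹ * P') * (P * (1 - θ • P)⁻¹)) := by
    have e1 : (1 - θ' • P')⁻¹ * ((1 - θ' • P') * P - P' * (1 - θ • P)) * (1 - θ • P)⁻¹
        = P * (1 - θ • P)⁻¹ - (1 - θ' • P')⁻¹ * P' := by
      rw [Matrix.mul_sub, Matrix.sub_mul, ← Matrix.mul_assoc, Matrix.nonsing_inv_mul _ hu',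
        Matrix.one_mul, Matrix.mul_assoc _ (P' * _), Matrix.mul_assoc P',
        Matrix.mul_nonsing_inv _ hu, Matrix.mul_one]
    have e2 : (1 - θ' • P') * P - P' * (1 - θ • P) = (P - P') + (θ - θ') • (P' * P) := by
      simp only [Matrix.sub_mul, Matrix.mul_sub, Matrix.one_mul, Matrix.mul_one, Matrix.smul_mul,
        Matrix.mul_smul, sub_smul]
      abel
    rw [← e1, e2]
    simp only [Matrix.mul_add, Matrix.add_mul, Matrix.sub_mul, Matrix.mul_sub, Matrix.one_mul,
      Matrix.mul_one, Matrix.mul_smul, Matrix.smul_mul, Matrix.mul_assoc]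
    abel
  rw [key]
  have t1 := norm_mul₃_le _ _ _ hN1' (le_refl ‖P - P'‖) hN
  have t2 : ‖(P - P') * ((1 - θ • P)⁻¹ - 1)‖ ≤ ‖P - P'‖ * (n * e) :=
    (norm_mul_le _ _).trans (mul_le_mul_of_nonneg_left hN1 (norm_nonneg _))
  have t3 : ‖(θ - θ') • (((1 - θ' • P')⁻¹ * P') * (P * (1 - θ • P)⁻¹))‖
      ≤ e * (4 * n ^ 3 * b / τ ^ 3) * ‖P - P'‖ * (2 * n * b * (b * (2 * n))) := by
    rw [norm_smul, Real.norm_eq_abs]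
    refine mul_le_mul habs ?_ (norm_nonneg _) (by positivity)
    refine (norm_mul_le _ _).trans (mul_le_mul ?_ ?_ (norm_nonneg _) (by positivity))
    · exact (norm_mul_le _ _).trans (mul_le_mul hN' hPb' (norm_nonneg _) (by positivity))
    · exact (norm_mul_le _ _).trans (mul_le_mul hPb hN (norm_nonneg _) hb.le)
  refine (norm_add_le _ _).trans ((add_le_add (norm_add_le _ _) le_rfl).trans ?_)
  calc _ ≤ n * e * ‖P - P'‖ * (2 * n) + ‖P - P'‖ * (n * e)
        + e * (4 * n ^ 3 * b / τ ^ 3) * ‖P - P'‖ * (2 * n * b * (b * (2 * n))) :=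
        add_le_add (add_le_add t1 t2) t3
    _ = e * L * ‖P - P'‖ := by
        rw [hL]
        ring
    _ ≤ η * ‖P - P'‖ := mul_le_mul_of_nonneg_right heη (norm_nonneg _)

end Lipschitz

/-! ### Global attraction for the robust Riccati iteration -/

section Dynamics

variable {n p q : ℕ} {A : Matrix (Fin n) (Fin n) ℝ} {B : Matrix (Fin n) (Fin q) ℝ}
  {C : Matrix (Fin p) (Fin n) ℝ} {D : Matrix (Fin p) (Fin q) ℝ}

theorem posSemidef_robustRiccati (hD : (D * Dᵀ).PosDef) {c : ℝ} (hc : 0 < c)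
    {P : Matrix (Fin n) (Fin n) ℝ} (hP : P.PosSemidef) :
    (robustRiccati A B C D c P).PosSemidef :=
  posSemidef_riccati A B C hD (posSemidef_distort_riskParam hP hc)

theorem posSemidef_robustRiccati_iterate (hD : (D * Dᵀ).PosDef) {c : ℝ} (hc : 0 < c)
    {P : Matrix (Fin n) (Fin n) ℝ} (hP : P.PosSemidef) (t : ℕ) :
    ((robustRiccati A B C D c)^[t] P).PosSemidef := by
  induction t with
  | zero => exact hP
  | succ t ih =>
    rw [Function.iterate_succ_apply']
    exact posSemidef_robustRiccati hD hc ih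

theorem qf_riccati_iterate_zero_le (hD : (D * Dᵀ).PosDef) {c κ : ℝ} (hc : 0 < c)
    (hκ : 1 ≤ κ) (hcκ : 2 * c < κ - 1 - Real.log κ) {P : Matrix (Fin n) (Fin n) ℝ}
    (hP : P.PosSemidef) (t : ℕ) (x : Fin n → ℝ) :
    qf ((riccati A B C D)^[t] 0) x ≤ qf ((robustRiccati A B C D c)^[t] P) x := by
  induction t generalizing x with
  | zero =>
    rw [Function.iterate_zero, id, qf_zero]
    exact qf_nonneg hP x
  | succ t ih =>
    rw [Function.iterate_succ_apply', Function.iterate_succ_apply', robustRiccati]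
    have hX := posSemidef_robustRiccati_iterate (A := A) (B := B) (C := C) hD hc hP t
    have h := riskParam_bounds hX hc hκ hcκ
    exact qf_riccati_mono A B C hD (posSemidef_riccati_iterate A B C hD Matrix.PosSemidef.zero t)
      (posSemidef_distort_riskParam hX hc) (fun y => (ih y).trans (h.2 y).1) x

theorem abs_qf_le_qf {M W : Matrix (Fin n) (Fin n) ℝ} (hM : Mᵀ = M)
    (hlow : ∀ x, x ⬝ᵥ x ≤ qf W x) (x : Fin n → ℝ) : |qf M x| ≤ ‖M‖ * qf W x :=
  (abs_qf_le_norm hM x).trans (mul_le_mul_of_nonneg_left (hlow x) (norm_nonneg _))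

theorem norm_le_of_abs_qf_le_qf {M W : Matrix (Fin n) (Fin n) ℝ} (hM : Mᵀ = M) (hWt : Wᵀ = W)
    {ε : ℝ} (hε : 0 ≤ ε) (h : ∀ x, |qf M x| ≤ ε * qf W x) : ‖M‖ ≤ n * (ε * ‖W‖) := by
  refine norm_le_of_abs_qf_le hM (by positivity) fun x => (h x).trans ?_
  rw [mul_assoc]
  exact mul_le_mul_of_nonneg_left (qf_le_norm hWt x) hε

/-- Every orbit of the robust Riccati map ends up close to the standard fixed point, as soon as the
distortion factor `κ` is close enough to `1`. -/
theorem eventually_abs_qf_sub_le (hD : (D * Dᵀ).PosDef) {Pbar : Matrix (Fin n) (Fin n) ℝ}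
    (hP : Pbar.PosSemidef) (hfix : riccati A B C D Pbar = Pbar)
    (hzero : Tendsto (fun t : ℕ => (riccati A B C D)^[t] 0) atTop (𝓝 Pbar))
    {W : Matrix (Fin n) (Fin n) ℝ} {ρ : ℝ} (hlow : ∀ x, x ⬝ᵥ x ≤ qf W x) (hρ0 : 0 < ρ)
    (hρ1 : ρ < 1) (hW : ∀ x, qf W ((A - gain A C D Pbar * C)ᵀ *ᵥ x) ≤ ρ * qf W x)
    {δ c κ : ℝ} (hδ : 0 < δ) (hc : 0 < c) (hκ : 1 ≤ κ) (hcκ : 2 * c < κ - 1 - Real.log κ)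
    (hκρ : κ * ρ ≤ (1 + ρ) / 2) (hκδ : (κ - 1) * ‖Pbar‖ ≤ (1 - ρ) / 4 * δ)
    {P₀ : Matrix (Fin n) (Fin n) ℝ} (hP₀ : P₀.PosSemidef) :
    ∀ᶠ t : ℕ in atTop, ∀ x, |qf ((robustRiccati A B C D c)^[t] P₀ - Pbar) x| ≤ δ * qf W x := by
  have hPt := transpose_of_posSemidef hP
  have hWnn : ∀ x, 0 ≤ qf W x := fun x => (dot_self_nonneg x).trans (hlow x)
  have hpsd := fun t => posSemidef_robustRiccati_iterate (A := A) (B := B) (C := C) hD hc hP₀ t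
  set σ := (1 + ρ) / 2 with hσ
  have hup : ∀ (t : ℕ) x, qf ((robustRiccati A B C D c)^[t] P₀ - Pbar) x
      ≤ (‖P₀ - Pbar‖ * σ ^ t + δ / 2) * qf W x := by
    intro t
    induction t with
    | zero =>
      intro x
      have h1 := abs_qf_le_qf (M := P₀ - Pbar)
        (by rw [Matrix.transpose_sub, transpose_of_posSemidef hP₀, hPt]) hlow x
      have h2 := (le_abs_self _).trans h1
      rw [Function.iterate_zero, id, pow_zero, mul_one]
      nlinarith [hWnn x]
    | succ t ih =>
      intro x
      rw [Function.iterate_succ_apply', robustRiccati]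
      set P := (robustRiccati A B C D c)^[t] P₀
      set y := (A - gain A C D Pbar * C)ᵀ *ᵥ x
      have hbd := riskParam_bounds (hpsd t) hc hκ hcκ
      have h1 := qf_riccati_sub_le A B C hD (posSemidef_distort_riskParam (hpsd t) hc) hP x
      rw [hfix, ← qf_sub, qf_sub (distort _ _)] at h1
      have h2 := (hbd.2 y).2
      have h3 := ih y
      rw [qf_sub] at h3
      have h4 : (κ - 1) * qf Pbar y ≤ (1 - ρ) / 4 * δ * qf W y := by
        calc (κ - 1) * qf Pbar y ≤ (κ - 1) * (‖Pbar‖ * qf W y) :=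
              mul_le_mul_of_nonneg_left ((le_abs_self _).trans (abs_qf_le_qf hPt hlow y))
                (by linarith)
          _ = (κ - 1) * ‖Pbar‖ * qf W y := by ring
          _ ≤ _ := mul_le_mul_of_nonneg_right hκδ (hWnn y)
      set a := ‖P₀ - Pbar‖ * σ ^ t + δ / 2 with ha
      have ha0 : 0 ≤ a := by positivity
      have h5 := mul_le_mul_of_nonneg_left h3 (show 0 ≤ κ by linarith)
      have h6 : qf (riccati A B C D (distort P (riskParam c P)) - Pbar) x
          ≤ (κ * a + (1 - ρ) / 4 * δ) * qf W y := by linarith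
      have hcoef : 0 ≤ κ * a + (1 - ρ) / 4 * δ := by
        have : 0 ≤ (1 - ρ) / 4 * δ := mul_nonneg (by linarith) hδ.le
        have : 0 ≤ κ * a := mul_nonneg (by linarith) ha0
        linarith
      refine h6.trans ((mul_le_mul_of_nonneg_left (hW x) hcoef).trans ?_)
      rw [← mul_assoc]
      refine mul_le_mul_of_nonneg_right ?_ (hWnn x)
      have h7 : κ * ρ * a ≤ σ * a := mul_le_mul_of_nonneg_right hκρ ha0
      have h8 : (1 - ρ) / 4 * δ * ρ ≤ (1 - ρ) / 4 * δ :=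
        mul_le_of_le_one_right (mul_nonneg (by linarith) hδ.le) hρ1.le
      calc (κ * a + (1 - ρ) / 4 * δ) * ρ ≤ σ * a + (1 - ρ) / 4 * δ := by linarith
        _ = ‖P₀ - Pbar‖ * σ ^ (t + 1) + δ / 2 := by
          rw [ha, hσ]
          ring
  have hσ0 : 0 ≤ σ := by positivity
  have hσ1 : σ < 1 := by linarith
  have hev1 : ∀ᶠ t : ℕ in atTop, ‖P₀ - Pbar‖ * σ ^ t ≤ δ / 2 := by
    have h := (tendsto_pow_atTop_nhds_zero_of_lt_one hσ0 hσ1).const_mul ‖P₀ - Pbar‖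
    rw [mul_zero] at h
    exact h.eventually_le_const (by positivity)
  have hev2 : ∀ᶠ t : ℕ in atTop, ‖(riccati A B C D)^[t] 0 - Pbar‖ ≤ δ :=
    ((tendsto_iff_norm_sub_tendsto_zero).1 hzero).eventually_le_const hδ
  filter_upwards [hev1, hev2] with t h1 h2 x
  rw [abs_le]
  constructor
  · have h3 := (neg_abs_le _).trans' (neg_le_neg (abs_qf_le_qf
      (M := (riccati A B C D)^[t] 0 - Pbar) (by
        rw [Matrix.transpose_sub, hPt, transpose_of_posSemidef
          (posSemidef_riccati_iterate A B C hD Matrix.PosSemidef.zero t)]) hlow x))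
    have h4 := qf_riccati_iterate_zero_le (A := A) (B := B) (C := C) hD hc hκ hcκ hP₀ t x
    have h5 := mul_le_mul_of_nonneg_right h2 (hWnn x)
    rw [qf_sub] at h3 ⊢
    linarith
  · exact (hup t x).trans (mul_le_mul_of_nonneg_right (by linarith) (hWnn x))

theorem exists_diag_pos {P : Matrix (Fin n) (Fin n) ℝ} (hP : P.PosSemidef) (h0 : P ≠ 0) :
    ∃ i, 0 < P i i := by
  by_contra! h
  apply h0
  refine Matrix.ext_of_mulVec_single fun i => ?_
  rw [Matrix.zero_mulVec]
  refine mulVec_eq_zero_of_qf hP (le_antisymm ?_ (qf_nonneg hP _))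
  rw [qf_single]
  exact h i

/-- Near a nonzero standard fixed point the robust Riccati map is a contraction for the gauge
`inf {ε | -ε W ≤ Δ ≤ ε W}`, where `W` is the Lyapunov function of the closed loop. -/
theorem exists_contraction (hD : (D * Dᵀ).PosDef) {Pbar : Matrix (Fin n) (Fin n) ℝ}
    (hP : Pbar.PosSemidef) (hP0 : Pbar ≠ 0)
    {W : Matrix (Fin n) (Fin n) ℝ} {ρ : ℝ} (hWt : Wᵀ = W) (hlow : ∀ x, x ⬝ᵥ x ≤ qf W x)
    (hρ0 : 0 < ρ) (hρ1 : ρ < 1)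
    (hW : ∀ x, qf W ((A - gain A C D Pbar * C)ᵀ *ᵥ x) ≤ ρ * qf W x) :
    ∃ δ κ₀ r : ℝ, 0 < δ ∧ 1 < κ₀ ∧ 0 ≤ r ∧ r < 1 ∧ ∀ κ c : ℝ, 1 ≤ κ → κ ≤ κ₀ → 0 < c →
      2 * c < κ - 1 - Real.log κ → ∀ P P' : Matrix (Fin n) (Fin n) ℝ, P.PosSemidef →
        P'.PosSemidef → (∀ x, |qf (P - Pbar) x| ≤ δ * qf W x) →
        (∀ x, |qf (P' - Pbar) x| ≤ δ * qf W x) → ∀ ε : ℝ, 0 ≤ ε →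
        (∀ x, |qf (P - P') x| ≤ ε * qf W x) →
        ∀ x, |qf (robustRiccati A B C D c P - robustRiccati A B C D c P') x|
          ≤ r * ε * qf W x := by
  obtain ⟨i, hi⟩ := exists_diag_pos hP hP0
  have hPt := transpose_of_posSemidef hP
  have hWnn : ∀ x, 0 ≤ qf W x := fun x => (dot_self_nonneg x).trans (hlow x)
  set σ := (1 + ρ) / 2 with hσ
  have hσ0 : 0 < σ := by positivity
  have hσ1 : σ < 1 := by linarith
  -- by continuity, nearby gains still have `W` as a Lyapunov function
  obtain ⟨s, hs, hsW⟩ : ∃ s : ℝ, 0 < s ∧ ∀ Z : Matrix (Fin n) (Fin n) ℝ, ‖Z - Pbar‖ < s →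
      ∀ x, qf W ((A - gain A C D Z * C)ᵀ *ᵥ x) ≤ σ * qf W x := by
    let g : Matrix (Fin n) (Fin n) ℝ → Matrix (Fin n) (Fin n) ℝ := fun Z =>
      (A - gain A C D Z * C) * W * (A - gain A C D Z * C)ᵀ
    have hcl : ContinuousAt (fun Z => A - gain A C D Z * C) Pbar :=
      continuousAt_const.sub
        (continuousAt_matrix_mul (continuousAt_gain A C hD hP) continuousAt_const)
    have hg : ContinuousAt g Pbar := by
      refine continuousAt_matrix_mul (continuousAt_matrix_mul hcl continuousAt_const) ?_
      exact (continuous_id.matrix_transpose.continuousAt).comp hcl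
    obtain ⟨s, hs, hg'⟩ := Metric.continuousAt_iff.1 hg (σ - ρ) (by linarith)
    refine ⟨s, hs, fun Z hZ x => ?_⟩
    have h1 := hg' (by rwa [dist_eq_norm])
    rw [dist_eq_norm] at h1
    have h2 := abs_qf_le_qf (M := g Z - g Pbar) (by
      simp only [g, Matrix.transpose_sub, Matrix.transpose_mul, Matrix.transpose_transpose, hWt,
        Matrix.mul_assoc]) hlow x
    have h3 := (le_abs_self _).trans h2
    have h4 := mul_le_mul_of_nonneg_right h1.le (hWnn x)
    simp only [g, qf_sub, qf_conj] at h3 h4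
    linarith [hW x]
  set s' := min s (Pbar i i / 2) with hs'
  have hs'0 : 0 < s' := lt_min hs (by positivity)
  set w : ℝ := n * ‖W‖ with hw
  have hw0 : 0 ≤ w := by positivity
  set δ := s' / (3 * w + 1) with hδ
  have hδ0 : 0 < δ := by positivity
  have hδs : 3 * δ * w < s' := by
    have h1 : δ * (3 * w + 1) = s' := div_mul_cancel₀ _ (by positivity)
    nlinarith
  set η := (1 - σ) / (w + 1) with hη
  have hη0 : 0 < η := div_pos (by linarith) (by positivity)
  have hηw : η * w ≤ 1 - σ := by
    rw [hη, div_mul_eq_mul_div, div_le_iff₀ (by positivity)]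
    nlinarith
  obtain ⟨κ₁, hκ₁, hlip⟩ := exists_distort_lipschitz i (b := ‖Pbar‖ + s') (τ := Pbar i i / 2)
    (η := η) (by positivity) (by positivity) hη0
  refine ⟨δ, min κ₁ (1 + min 1 (δ / (‖Pbar‖ + 1))), (2 - σ) * σ, hδ0, ?_,
    mul_nonneg (by linarith) hσ0.le, by nlinarith, ?_⟩
  · refine lt_min hκ₁ ?_
    have : 0 < min 1 (δ / (‖Pbar‖ + 1)) := by positivity
    linarith
  intro κ c hκ hκle hc hcκ P P' hPp hPp' hPδ hPδ' ε hε hPP'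
  have hκκ₁ : κ ≤ κ₁ := hκle.trans (min_le_left _ _)
  have hκ2 : κ ≤ 2 := by
    have := hκle.trans (min_le_right _ _)
    linarith [min_le_left 1 (δ / (‖Pbar‖ + 1))]
  have hκδ : (κ - 1) * ‖Pbar‖ ≤ δ := by
    have h1 : κ - 1 ≤ δ / (‖Pbar‖ + 1) := by
      have := hκle.trans (min_le_right _ _)
      linarith [min_le_right 1 (δ / (‖Pbar‖ + 1))]
    rw [le_div_iff₀ (by positivity)] at h1
    linarith
  have hone : ∀ X : Matrix (Fin n) (Fin n) ℝ, X.PosSemidef →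
      (∀ x, |qf (X - Pbar) x| ≤ δ * qf W x) →
      ‖X‖ ≤ ‖Pbar‖ + s' ∧ Pbar i i / 2 ≤ X i i ∧
        ∀ x, qf W ((A - gain A C D (distort X (riskParam c X)) * C)ᵀ *ᵥ x) ≤ σ * qf W x := by
    intro X hX hXδ
    have hXt := transpose_of_posSemidef hX
    have hbd := riskParam_bounds hX hc hκ hcκ
    have hnX : ‖X - Pbar‖ ≤ s' := by
      have h1 := norm_le_of_abs_qf_le_qf (by rw [Matrix.transpose_sub, hXt, hPt]) hWt hδ0.le hXδ
      have h2 : (n : ℝ) * (δ * ‖W‖) = δ * w := by rw [hw]; ring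
      nlinarith [mul_nonneg hδ0.le hw0]
    refine ⟨?_, ?_, ?_⟩
    · calc ‖X‖ = ‖Pbar + (X - Pbar)‖ := by rw [add_sub_cancel]
        _ ≤ ‖Pbar‖ + ‖X - Pbar‖ := norm_add_le _ _
        _ ≤ ‖Pbar‖ + s' := by linarith
    · have h1 := (abs_entry_le_norm (X - Pbar) i i).trans (hnX.trans (min_le_right _ _))
      rw [Matrix.sub_apply, abs_le] at h1
      linarith [h1.1]
    · refine hsW _ ?_
      have h1 : ∀ x, |qf (distort X (riskParam c X) - Pbar) x| ≤ 3 * δ * qf W x := fun x => by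
        obtain ⟨h2, h3⟩ := hbd.2 x
        have h4 := hXδ x
        rw [qf_sub, abs_le] at h4 ⊢
        have h5 := mul_nonneg hδ0.le (hWnn x)
        have h6 : (κ - 1) * qf Pbar x ≤ δ * qf W x := by
          calc (κ - 1) * qf Pbar x ≤ (κ - 1) * (‖Pbar‖ * qf W x) :=
                mul_le_mul_of_nonneg_left ((le_abs_self _).trans (abs_qf_le_qf hPt hlow x))
                  (by linarith)
            _ = (κ - 1) * ‖Pbar‖ * qf W x := by ring
            _ ≤ _ := mul_le_mul_of_nonneg_right hκδ (hWnn x)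
        have h7 : κ * (qf X x - qf Pbar x) ≤ 2 * (δ * qf W x) := by
          nlinarith [h4.2]
        constructor
        · linarith [h4.1]
        · linarith
      have h2 := norm_le_of_abs_qf_le_qf (by
        rw [Matrix.transpose_sub, transpose_of_posSemidef (posSemidef_distort_riskParam hX hc), hPt])
        hWt (by positivity) h1
      have h3 : (n : ℝ) * (3 * δ * ‖W‖) = 3 * δ * w := by rw [hw]; ring
      rw [h3] at h2
      exact (h2.trans_lt hδs).trans_le (min_le_left _ _)
  obtain ⟨hb, hii, hgain⟩ := hone P hPp hPδ
  obtain ⟨hb', hii', hgain'⟩ := hone P' hPp' hPδ'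
  have hl := hlip κ c hκ hκκ₁ hc hcκ P P' hPp hPp' hb hb' hii hii'
  have hT := posSemidef_distort_riskParam hPp hc
  have hT' := posSemidef_distort_riskParam hPp' hc
  rw [robustRiccati, robustRiccati]
  set T := distort P (riskParam c P)
  set T' := distort P' (riskParam c P')
  have hTt := transpose_of_posSemidef hT
  have hTt' := transpose_of_posSemidef hT'
  have hPpt := transpose_of_posSemidef hPp
  have hPpt' := transpose_of_posSemidef hPp'
  -- the distortion expands the gauge by a factor of at most `2 - σ`
  have hTT : ∀ x, |qf (T - T') x| ≤ (2 - σ) * ε * qf W x := fun x => by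
    have h1 := abs_qf_le_qf (M := T - T' - (P - P'))
      (by simp only [Matrix.transpose_sub, hTt, hTt', hPpt, hPpt']) hlow x
    have h2 := norm_le_of_abs_qf_le_qf (by rw [Matrix.transpose_sub, hPpt, hPpt']) hWt hε hPP'
    have h3 : ‖T - T' - (P - P')‖ ≤ (1 - σ) * ε := by
      refine (hl.trans (mul_le_mul_of_nonneg_left h2 hη0.le)).trans ?_
      have h4 : η * (n * (ε * ‖W‖)) = η * w * ε := by rw [hw]; ring
      rw [h4]
      exact mul_le_mul_of_nonneg_right hηw hε
    have h5 := mul_le_mul_of_nonneg_right h3 (hWnn x)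
    have h6 : qf (T - T') x = qf (T - T' - (P - P')) x + qf (P - P') x := by
      rw [qf_sub (T - T')]
      ring
    rw [h6]
    refine (abs_add_le _ _).trans ?_
    linarith [hPP' x]
  intro x
  have hcoef : 0 ≤ (2 - σ) * ε := mul_nonneg (by linarith) hε
  have hside : ∀ X X' : Matrix (Fin n) (Fin n) ℝ, X.PosSemidef → X'.PosSemidef →
      (∀ x, qf (X - X') x ≤ (2 - σ) * ε * qf W x) →
      (∀ x, qf W ((A - gain A C D X' * C)ᵀ *ᵥ x) ≤ σ * qf W x) →
      qf (riccati A B C D X) x - qf (riccati A B C D X') x ≤ (2 - σ) * σ * ε * qf W x := by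
    intro X X' hX hX' h1 h2
    refine (qf_riccati_sub_le A B C hD hX hX' x).trans ((h1 _).trans ?_)
    refine (mul_le_mul_of_nonneg_left (h2 x) hcoef).trans (le_of_eq ?_)
    ring
  rw [qf_sub, abs_le]
  constructor
  · have := hside T' T hT' hT (fun y => by
      have := (abs_le.1 (hTT y)).1
      rw [qf_sub] at this ⊢
      linarith) hgain
    linarith
  · exact hside T T' hT hT' (fun y => (abs_le.1 (hTT y)).2) hgain'

/-- For small tolerances the robust Riccati map has a globally attracting fixed point, which lies
above the standard one. -/
theorem exists_robust_attractor (hD : (D * Dᵀ).PosDef) {Pbar : Matrix (Fin n) (Fin n) ℝ}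
    (hP : Pbar.PosSemidef) (hfix : riccati A B C D Pbar = Pbar)
    (hzero : Tendsto (fun t : ℕ => (riccati A B C D)^[t] 0) atTop (𝓝 Pbar))
    {W : Matrix (Fin n) (Fin n) ℝ} {ρ : ℝ} (hWt : Wᵀ = W) (hlow : ∀ x, x ⬝ᵥ x ≤ qf W x)
    (hρ0 : 0 < ρ) (hρ1 : ρ < 1)
    (hW : ∀ x, qf W ((A - gain A C D Pbar * C)ᵀ *ᵥ x) ≤ ρ * qf W x) :
    ∃ cMax : ℝ, 0 < cMax ∧ ∀ c : ℝ, 0 < c → c < cMax →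
      ∃ Pinf : Matrix (Fin n) (Fin n) ℝ, Pinf.PosSemidef ∧ robustRiccati A B C D c Pinf = Pinf ∧
        (∀ x, qf Pbar x ≤ qf Pinf x) ∧
        ∀ P₀ : Matrix (Fin n) (Fin n) ℝ, P₀.PosSemidef →
          Tendsto (fun t : ℕ => (robustRiccati A B C D c)^[t] P₀) atTop (𝓝 Pinf) := by
  have hPt := transpose_of_posSemidef hP
  have hWnn : ∀ x, 0 ≤ qf W x := fun x => (dot_self_nonneg x).trans (hlow x)
  have hlogpos : ∀ κ : ℝ, 1 < κ → 0 < (κ - 1 - Real.log κ) / 2 := fun κ hκ => by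
    have := Real.log_lt_sub_one_of_pos (by linarith) hκ.ne'
    linarith
  have hκρ : ∀ κ, κ ≤ 1 + (1 - ρ) / 2 → κ * ρ ≤ (1 + ρ) / 2 := fun κ hκ => by nlinarith
  by_cases hP0 : Pbar = 0
  · subst hP0
    set κ := 1 + (1 - ρ) / 2 with hκ
    have hκ1 : 1 < κ := by linarith
    refine ⟨_, hlogpos κ hκ1, fun c hc hcm => ⟨0, hP, ?_, fun x => le_rfl, fun P₀ hP₀ => ?_⟩⟩
    · rw [robustRiccati, distort_zero, hfix]
    have hcκ : 2 * c < κ - 1 - Real.log κ := by linarith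
    refine tendsto_of_tendsto_qf (fun t => transpose_of_posSemidef
      (posSemidef_robustRiccati_iterate hD hc hP₀ t)) hPt fun x => ?_
    rw [Metric.tendsto_nhds]
    intro ε hε
    have h := eventually_abs_qf_sub_le hD hP hfix hzero hlow hρ0 hρ1 hW
      (δ := ε / (qf W x + 1)) (by have := hWnn x; positivity) hc hκ1.le hcκ (hκρ κ le_rfl)
      (by
        rw [norm_zero, mul_zero]
        have := hWnn x
        exact mul_nonneg (by linarith) (by positivity)) hP₀
    filter_upwards [h] with t ht
    have h1 := ht x
    rw [sub_zero] at h1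
    rw [qf_zero, Real.dist_0_eq_abs]
    refine h1.trans_lt ?_
    have h2 := hWnn x
    rw [div_mul_eq_mul_div, div_lt_iff₀ (by positivity)]
    linarith
  obtain ⟨δ, κ₀, r, hδ, hκ₀, hr0, hr1, hcontr⟩ :=
    exists_contraction (A := A) (B := B) (C := C) hD hP hP0 hWt hlow hρ0 hρ1 hW
  set m := min (min ((1 - ρ) / 2) (κ₀ - 1)) ((1 - ρ) / 4 * δ / (‖Pbar‖ + 1)) with hm
  have hm0 : 0 < m := by
    refine lt_min (lt_min (by linarith) (by linarith)) ?_
    have : 0 < 1 - ρ := by linarith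
    positivity
  have hm1 : m ≤ (1 - ρ) / 2 := (min_le_left _ _).trans (min_le_left _ _)
  have hm2 : m ≤ κ₀ - 1 := (min_le_left _ _).trans (min_le_right _ _)
  have hm3 : m * ‖Pbar‖ ≤ (1 - ρ) / 4 * δ := by
    have h : m ≤ (1 - ρ) / 4 * δ / (‖Pbar‖ + 1) := min_le_right _ _
    rw [le_div_iff₀ (by positivity)] at h
    linarith
  have hκ1 : 1 < 1 + m := by linarith
  refine ⟨_, hlogpos (1 + m) hκ1, fun c hc hcm => ?_⟩
  have hcκ : 2 * c < 1 + m - 1 - Real.log (1 + m) := by linarith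
  have hctr := hcontr (1 + m) c hκ1.le (by linarith) hc hcκ
  set f := robustRiccati A B C D c with hf
  have hfpsd : ∀ {P : Matrix (Fin n) (Fin n) ℝ}, P.PosSemidef → (f P).PosSemidef :=
    fun hX => posSemidef_robustRiccati hD hc hX
  have hpsd : ∀ {P : Matrix (Fin n) (Fin n) ℝ}, P.PosSemidef → ∀ t : ℕ, (f^[t] P).PosSemidef :=
    fun hX t => posSemidef_robustRiccati_iterate hD hc hX t
  have hnear : ∀ {P : Matrix (Fin n) (Fin n) ℝ}, P.PosSemidef →
      ∃ t₀ : ℕ, ∀ t ≥ t₀, ∀ x, |qf (f^[t] P - Pbar) x| ≤ δ * qf W x := fun hX =>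
    eventually_atTop.1 (eventually_abs_qf_sub_le hD hP hfix hzero hlow hρ0 hρ1 hW hδ hc hκ1.le hcκ
      (hκρ _ (by linarith)) (by rwa [add_sub_cancel_left]) hX)
  -- any two orbits approach each other geometrically
  have hpair : ∀ {P P' : Matrix (Fin n) (Fin n) ℝ}, P.PosSemidef → P'.PosSemidef →
      ∃ t₀ : ℕ, ∀ k : ℕ, ‖f^[k + t₀] P - f^[k + t₀] P'‖ ≤ n * (2 * δ * ‖W‖) * r ^ k := by
    intro P P' hX hX'
    obtain ⟨t₁, h1⟩ := hnear hX
    obtain ⟨t₂, h2⟩ := hnear hX'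
    refine ⟨max t₁ t₂, fun k => ?_⟩
    have h1' : ∀ k x, |qf (f^[k + max t₁ t₂] P - Pbar) x| ≤ δ * qf W x := fun k =>
      h1 _ ((le_max_left _ _).trans (Nat.le_add_left _ _))
    have h2' : ∀ k x, |qf (f^[k + max t₁ t₂] P' - Pbar) x| ≤ δ * qf W x := fun k =>
      h2 _ ((le_max_right _ _).trans (Nat.le_add_left _ _))
    have hq : ∀ k x, |qf (f^[k + max t₁ t₂] P - f^[k + max t₁ t₂] P') x|
        ≤ r ^ k * (2 * δ) * qf W x := by
      intro k
      induction k with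
      | zero =>
        intro x
        have e1 := h1' 0 x
        have e2 := h2' 0 x
        rw [qf_sub, abs_le] at e1 e2
        rw [qf_sub, abs_le, pow_zero, one_mul]
        constructor <;> linarith [e1.1, e1.2, e2.1, e2.2]
      | succ k ih =>
        intro x
        rw [Nat.succ_add, Function.iterate_succ_apply', Function.iterate_succ_apply', pow_succ',
          mul_assoc r]
        exact hctr _ _ (hpsd hX _) (hpsd hX' _) (h1' k) (h2' k) _ (by positivity) ih x
    have h3 := norm_le_of_abs_qf_le_qf (by
      rw [Matrix.transpose_sub, transpose_of_posSemidef (hpsd hX _),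
        transpose_of_posSemidef (hpsd hX' _)]) hWt (by positivity) (hq k)
    refine h3.trans (le_of_eq ?_)
    ring
  have hrpow := tendsto_pow_atTop_nhds_zero_of_lt_one hr0 hr1
  -- the orbit of the standard fixed point converges
  obtain ⟨Pinf, hPinf⟩ : ∃ Pinf, Tendsto (fun t : ℕ => f^[t] Pbar) atTop (𝓝 Pinf) := by
    obtain ⟨t₀, h⟩ := hpair hP (hpsd hP 1)
    have hcau : CauchySeq fun k : ℕ => f^[k + t₀] Pbar := by
      refine cauchySeq_of_le_geometric r (n * (2 * δ * ‖W‖)) hr1 fun k => ?_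
      have h1 := h k
      rw [← Function.iterate_add_apply] at h1
      rw [dist_eq_norm, Nat.add_right_comm]
      exact h1
    have : CompleteSpace (Matrix (Fin n) (Fin n) ℝ) := FiniteDimensional.complete ℝ _
    obtain ⟨L, hL⟩ := cauchySeq_tendsto_of_complete hcau
    exact ⟨L, (tendsto_add_atTop_iff_nat t₀).1 hL⟩
  have hall : ∀ P₀ : Matrix (Fin n) (Fin n) ℝ, P₀.PosSemidef →
      Tendsto (fun t : ℕ => f^[t] P₀) atTop (𝓝 Pinf) := by
    intro P₀ hP₀
    obtain ⟨t₀, h⟩ := hpair hP₀ hP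
    have h0 : Tendsto (fun k : ℕ => f^[k + t₀] P₀ - f^[k + t₀] Pbar) atTop (𝓝 0) := by
      refine squeeze_zero_norm h ?_
      have := hrpow.const_mul (n * (2 * δ * ‖W‖))
      rwa [mul_zero] at this
    have h1 := h0.add ((tendsto_add_atTop_iff_nat t₀).2 hPinf)
    rw [zero_add] at h1
    exact (tendsto_add_atTop_iff_nat t₀).1 (h1.congr fun k => by rw [sub_add_cancel])
  have hlimqf : ∀ x, Tendsto (fun t : ℕ => qf (f^[t] Pbar) x) atTop (𝓝 (qf Pinf x)) := fun x =>
    ((continuous_qf x).tendsto Pinf).comp hPinf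
  have hle : ∀ x, qf Pbar x ≤ qf Pinf x := fun x =>
    le_of_tendsto_of_tendsto (((continuous_qf x).tendsto Pbar).comp hzero) (hlimqf x)
      (Eventually.of_forall fun t => qf_riccati_iterate_zero_le hD hc hκ1.le hcκ hP t x)
  have hPinft : Pinfᵀ = Pinf := by
    have h1 := (continuous_id.matrix_transpose.tendsto Pinf).comp hPinf
    exact tendsto_nhds_unique (h1.congr fun t => transpose_of_posSemidef (hpsd hP t)) hPinf
  have hPinfpsd : Pinf.PosSemidef :=
    posSemidef_iff_qf.2 ⟨hPinft, fun x => (qf_nonneg hP x).trans (hle x)⟩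
  refine ⟨Pinf, hPinfpsd, ?_, hle, hall⟩
  -- the contraction property makes `f` continuous at the limit
  obtain ⟨t₀, h⟩ := hnear hP
  have hPδ : ∀ x, |qf (Pinf - Pbar) x| ≤ δ * qf W x := fun x => by
    have h1 : Tendsto (fun t : ℕ => |qf (f^[t] Pbar - Pbar) x|) atTop
        (𝓝 |qf (Pinf - Pbar) x|) :=
      (((continuous_qf x).tendsto _).comp (hPinf.sub_const Pbar)).abs
    exact le_of_tendsto h1 (eventually_atTop.2 ⟨t₀, fun t ht => h t ht x⟩)
  have hnorm : Tendsto (fun t : ℕ => ‖f^[t] Pbar - Pinf‖) atTop (𝓝 0) :=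
    tendsto_iff_norm_sub_tendsto_zero.1 hPinf
  have hfn : Tendsto (fun t : ℕ => f^[t + 1] Pbar - f Pinf) atTop (𝓝 0) := by
    have hbound : ∀ᶠ t : ℕ in atTop, ‖f^[t + 1] Pbar - f Pinf‖
        ≤ n * (r * ‖f^[t] Pbar - Pinf‖ * ‖W‖) := by
      filter_upwards [eventually_ge_atTop t₀] with t ht
      rw [Function.iterate_succ_apply']
      have hXt := transpose_of_posSemidef (hpsd hP t)
      refine norm_le_of_abs_qf_le_qf ?_ hWt (by positivity)
        (hctr _ _ (hpsd hP t) hPinfpsd (h t ht) hPδ _ (norm_nonneg _) fun x => ?_)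
      · rw [Matrix.transpose_sub, transpose_of_posSemidef (hfpsd hPinfpsd),
          transpose_of_posSemidef (hfpsd (hpsd hP t))]
      · exact abs_qf_le_qf (by rw [Matrix.transpose_sub, hXt, hPinft]) hlow x
    refine squeeze_zero_norm' hbound ?_
    have := ((hnorm.const_mul r).mul_const ‖W‖).const_mul (n : ℝ)
    simpa using this
  have h1 := hfn.add_const (f Pinf)
  rw [zero_add] at h1
  exact tendsto_nhds_unique (h1.congr fun t => by rw [sub_add_cancel])
    ((tendsto_add_atTop_iff_nat 1).2 hPinf)

end Dynamics

/-! ### Reduction to the image of the standard fixed point -/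

section Reduction

variable {n l : ℕ} {U : Matrix (Fin n) (Fin l) ℝ} (hU : Uᵀ * U = 1)

include hU

theorem compress_conj (X : Matrix (Fin l) (Fin l) ℝ) : Uᵀ * (U * X * Uᵀ) * U = X := by
  calc Uᵀ * (U * X * Uᵀ) * U = (Uᵀ * U) * X * (Uᵀ * U) := by simp only [Matrix.mul_assoc]
    _ = X := by rw [hU, Matrix.one_mul, Matrix.mul_one]

theorem dot_mulVec_isometry (y : Fin l → ℝ) : (U *ᵥ y) ⬝ᵥ (U *ᵥ y) = y ⬝ᵥ y := by
  have h := qf_mul_transpose Uᵀ y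
  rwa [Matrix.transpose_transpose, hU, qf_one, eq_comm] at h

theorem posDef_one_sub_conj_iff {X : Matrix (Fin l) (Fin l) ℝ} (hX : Xᵀ = X) :
    (1 - U * X * Uᵀ).PosDef ↔ (1 - X).PosDef := by
  rw [posDef_iff_qf, posDef_iff_qf]
  have hsym : (1 - U * X * Uᵀ)ᵀ = 1 - U * X * Uᵀ := by
    simp only [Matrix.transpose_sub, Matrix.transpose_one, Matrix.transpose_mul,
      Matrix.transpose_transpose, hX, Matrix.mul_assoc]
  have hsym' : (1 - X)ᵀ = 1 - X := by rw [Matrix.transpose_sub, Matrix.transpose_one, hX]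
  simp only [hsym, hsym', true_and, qf_sub, qf_one, qf_conj]
  constructor
  · intro h y hy
    have h1 := h (U *ᵥ y) fun h0 => hy <| by
      have := congrArg (Uᵀ *ᵥ ·) h0
      simpa only [Matrix.mulVec_mulVec, hU, Matrix.one_mulVec, Matrix.mulVec_zero] using this
    rwa [Matrix.mulVec_mulVec, hU, Matrix.one_mulVec, dot_mulVec_isometry hU] at h1
  · intro h x hx
    by_cases hy : Uᵀ *ᵥ x = 0
    · rw [hy]
      have h1 : qf X 0 = 0 := by simp [qf]
      rw [h1, sub_zero]
      exact lt_of_le_of_ne (dot_self_nonneg x) fun h0 => hx (dotProduct_self_eq_zero.1 h0.symm)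
    · -- Bessel's inequality
      have h1 := h _ hy
      have h2 := dot_self_nonneg (x - U *ᵥ (Uᵀ *ᵥ x))
      have h3 : x ⬝ᵥ U *ᵥ (Uᵀ *ᵥ x) = (Uᵀ *ᵥ x) ⬝ᵥ (Uᵀ *ᵥ x) := by
        rw [Matrix.dotProduct_mulVec, ← Matrix.mulVec_transpose]
      rw [sub_dotProduct, dotProduct_sub, dotProduct_sub, dot_mulVec_isometry hU,
        dotProduct_comm (U *ᵥ _) x, h3] at h2
      linarith

theorem inv_one_sub_conj_mul {X : Matrix (Fin l) (Fin l) ℝ} (h : (1 - X).PosDef)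
    (h' : (1 - U * X * Uᵀ).PosDef) : (1 - U * X * Uᵀ)⁻¹ * U = U * (1 - X)⁻¹ := by
  have hu : IsUnit (1 - X).det := (Matrix.isUnit_iff_isUnit_det _).1 h.isUnit
  have hu' : IsUnit (1 - U * X * Uᵀ).det := (Matrix.isUnit_iff_isUnit_det _).1 h'.isUnit
  have e : (1 - U * X * Uᵀ) * U = U * (1 - X) := by
    rw [Matrix.sub_mul, Matrix.mul_sub, Matrix.mul_assoc _ Uᵀ, hU, Matrix.one_mul, Matrix.mul_one,
      Matrix.mul_one]
  calc (1 - U * X * Uᵀ)⁻¹ * U = (1 - U * X * Uᵀ)⁻¹ * (U * (1 - X)) * (1 - X)⁻¹ := by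
        rw [Matrix.mul_assoc _ (U * (1 - X)), Matrix.mul_assoc U (1 - X),
          Matrix.mul_nonsing_inv _ hu, Matrix.mul_one]
    _ = U * (1 - X)⁻¹ := by
        rw [← e, ← Matrix.mul_assoc, Matrix.nonsing_inv_mul _ hu', Matrix.one_mul]

theorem divergence_conj {X : Matrix (Fin l) (Fin l) ℝ} (h : (1 - X).PosDef)
    (h' : (1 - U * X * Uᵀ).PosDef) : divergence (U * X * Uᵀ) = divergence X := by
  have hdet : (1 - U * X * Uᵀ).det = (1 - X).det := by
    rw [Matrix.mul_assoc, Matrix.det_one_sub_mul_comm, Matrix.mul_assoc, hU, Matrix.mul_one]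
  have htr : (U * X * Uᵀ * (1 - U * X * Uᵀ)⁻¹).trace = (X * (1 - X)⁻¹).trace := by
    rw [Matrix.mul_assoc, Matrix.mul_assoc, Matrix.trace_mul_comm, Matrix.mul_assoc,
      Matrix.mul_assoc, inv_one_sub_conj_mul hU h h', ← Matrix.mul_assoc Uᵀ, hU, Matrix.one_mul]
  rw [divergence, divergence, hdet, htr]

/-- The risk sensitivity parameter does not depend on the ambient space. -/
theorem riskParam_conj {X : Matrix (Fin l) (Fin l) ℝ} (hX : X.PosSemidef) (c : ℝ) :
    riskParam c (U * X * Uᵀ) = riskParam c X := by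
  have hX' : (U * X * Uᵀ).PosSemidef := by
    have := hX.mul_mul_conjTranspose_same U
    rwa [Matrix.conjTranspose_eq_transpose_of_trivial] at this
  have h : IsMultiplier c (U * X * Uᵀ) = IsMultiplier c X := by
    funext lam
    rw [eq_iff_iff, isMultiplier_iff hX', isMultiplier_iff hX]
    have e : lam⁻¹ • (U * X * Uᵀ) = U * (lam⁻¹ • X) * Uᵀ := by
      rw [Matrix.mul_smul, Matrix.smul_mul]
    rw [e]
    have hs : (lam⁻¹ • X)ᵀ = lam⁻¹ • X := by
      rw [Matrix.transpose_smul, transpose_of_posSemidef hX]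
    rw [posDef_one_sub_conj_iff hU hs]
    refine and_congr_right fun _ => and_congr_right fun h => ?_
    rw [divergence_conj hU h ((posDef_one_sub_conj_iff hU hs).2 h)]
  unfold riskParam
  rw [h]

omit hU in
theorem posDef_one_sub_riskParam_smul {X : Matrix (Fin l) (Fin l) ℝ} (hX : X.PosSemidef) {c : ℝ}
    (hc : 0 < c) (h0 : X ≠ 0 ∨ l = 0) : (1 - riskParam c X • X).PosDef := by
  rcases h0 with h0 | rfl
  · exact (riskParam_spec hX h0 hc).2.1
  · rw [Subsingleton.elim (1 - riskParam c X • X) 1]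
    exact Matrix.PosDef.one

variable {p q : ℕ} {A : Matrix (Fin n) (Fin n) ℝ} {B : Matrix (Fin n) (Fin q) ℝ}
  {C : Matrix (Fin p) (Fin n) ℝ} {D : Matrix (Fin p) (Fin q) ℝ}

/-- On positive definite matrices over an invariant subspace containing the image of `B`, the robust
Riccati map is the reduced one, by the matrix inversion lemma. -/
theorem robustRiccati_conj (hD : (D * Dᵀ).PosDef) (hA : U * (Uᵀ * A * U) = A * U)
    (hB : U * (Uᵀ * B) = B) {c : ℝ} (hc : 0 < c) {X : Matrix (Fin l) (Fin l) ℝ} (hX : X.PosDef) :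
    robustRiccati A B C D c (U * X * Uᵀ) = U * reducedRobustRiccati A B C D U c X * Uᵀ := by
  have hXt := transpose_of_posSemidef hX.posSemidef
  have hXu : IsUnit X.det := (Matrix.isUnit_iff_isUnit_det _).1 hX.isUnit
  have hX' : (U * X * Uᵀ).PosSemidef := by
    have := hX.posSemidef.mul_mul_conjTranspose_same U
    rwa [Matrix.conjTranspose_eq_transpose_of_trivial] at this
  have hpd : (1 - riskParam c X • X).PosDef := by
    refine posDef_one_sub_riskParam_smul hX.posSemidef hc ?_
    rcases l.eq_zero_or_pos with h | h
    · exact Or.inr h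
    · refine Or.inl ?_
      rintro rfl
      have := hX.diag_pos (i := ⟨0, h⟩)
      simp at this
  have hpd' : (1 - riskParam c X • (U * X * Uᵀ)).PosDef := by
    have e : riskParam c X • (U * X * Uᵀ) = U * (riskParam c X • X) * Uᵀ := by
      rw [Matrix.mul_smul, Matrix.smul_mul]
    rw [e]
    exact (posDef_one_sub_conj_iff hU (by rw [Matrix.transpose_smul, hXt])).2 hpd
  rw [robustRiccati, reducedRobustRiccati, riskParam_conj hU hX.posSemidef, distort_eq hX' hpd']
  set θ := riskParam c X
  have hu : IsUnit (1 - θ • X).det := (Matrix.isUnit_iff_isUnit_det _).1 hpd.isUnit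
  set Y := X * (1 - θ • X)⁻¹ with hY
  have hYpsd : Y.PosSemidef := by
    rw [hY, ← distort_eq hX.posSemidef hpd]
    exact posSemidef_distort hX.posSemidef hpd
  have hdist : U * X * Uᵀ * (1 - θ • (U * X * Uᵀ))⁻¹ = U * Y * Uᵀ := by
    have e : θ • (U * X * Uᵀ) = U * (θ • X) * Uᵀ := by
      rw [Matrix.mul_smul, Matrix.smul_mul]
    rw [e] at hpd' ⊢
    have h1 := inv_one_sub_conj_mul hU hpd hpd'
    have h2 := congrArg Matrix.transpose h1
    rw [Matrix.transpose_mul, Matrix.transpose_mul, transpose_of_posSemidef hpd.inv.posSemidef,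
      transpose_of_posSemidef hpd'.inv.posSemidef] at h2
    rw [Matrix.mul_assoc, h2, hY]
    simp only [Matrix.mul_assoc]
  have hinv : (X⁻¹ - θ • 1) * Y = 1 := by
    rw [hY, ← Matrix.mul_assoc, Matrix.sub_mul, Matrix.nonsing_inv_mul _ hXu, Matrix.smul_mul,
      Matrix.one_mul, Matrix.mul_nonsing_inv _ hu]
  have hinv' : (X⁻¹ - θ • 1)⁻¹ = Y := Matrix.inv_eq_right_inv hinv
  have hRu : IsUnit (D * Dᵀ).det := (Matrix.isUnit_iff_isUnit_det _).1 hD.isUnit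
  have hRR : ((D * Dᵀ)⁻¹)⁻¹ = D * Dᵀ := Matrix.nonsing_inv_nonsing_inv _ hRu
  have hS := innovation_posDef (C * U) hD hYpsd
  have hwood := Matrix.add_mul_mul_inv_eq_sub (A := X⁻¹ - θ • (1 : Matrix (Fin l) (Fin l) ℝ))
    (U := (C * U)ᵀ) (C := (D * Dᵀ)⁻¹) (V := C * U) (IsUnit.of_mul_eq_one _ hinv)
    hD.inv.isUnit (by
      rw [hRR, hinv', add_comm]
      exact hS.isUnit)
  rw [hwood, hRR, hinv', hdist, riccati]
  have hA' : Uᵀ * Aᵀ = (Uᵀ * A * U)ᵀ * Uᵀ := by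
    have h := congrArg Matrix.transpose hA
    rw [Matrix.transpose_mul, Matrix.transpose_mul A U] at h
    exact h.symm
  have hB' : Bᵀ = Bᵀ * U * Uᵀ := by
    have h := congrArg Matrix.transpose hB
    rw [Matrix.transpose_mul, Matrix.transpose_mul, Matrix.transpose_transpose] at h
    exact h.symm
  have hin : C * (U * Y * Uᵀ) * Cᵀ + D * Dᵀ = D * Dᵀ + C * U * Y * (C * U)ᵀ := by
    rw [add_comm, Matrix.transpose_mul]
    simp only [Matrix.mul_assoc]
  rw [hin]
  set G := (D * Dᵀ + C * U * Y * (C * U)ᵀ)⁻¹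
  set AR := Uᵀ * A * U with hAR
  have e1 : A * (U * Y * Uᵀ) * Aᵀ = U * (AR * Y * ARᵀ) * Uᵀ := by
    calc A * (U * Y * Uᵀ) * Aᵀ = (A * U) * Y * (Uᵀ * Aᵀ) := by simp only [Matrix.mul_assoc]
      _ = U * (AR * Y * ARᵀ) * Uᵀ := by rw [← hA, hA']; simp only [Matrix.mul_assoc]
  have e2 : A * (U * Y * Uᵀ) * Cᵀ * G * C * (U * Y * Uᵀ) * Aᵀ
      = U * (AR * (Y * (C * U)ᵀ * G * (C * U) * Y) * ARᵀ) * Uᵀ := by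
    calc A * (U * Y * Uᵀ) * Cᵀ * G * C * (U * Y * Uᵀ) * Aᵀ
        = (A * U) * (Y * (C * U)ᵀ * G * (C * U) * Y) * (Uᵀ * Aᵀ) := by
          rw [Matrix.transpose_mul]
          simp only [Matrix.mul_assoc]
      _ = _ := by rw [← hA, hA']; simp only [Matrix.mul_assoc]
  have e3 : B * Bᵀ = U * (Uᵀ * (B * Bᵀ) * U) * Uᵀ := by
    calc B * Bᵀ = (U * (Uᵀ * B)) * (Bᵀ * U * Uᵀ) := by rw [← hB', hB]
      _ = _ := by simp only [Matrix.mul_assoc]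
  rw [e1, e2]
  conv_lhs => rw [e3]
  simp only [Matrix.mul_add, Matrix.add_mul, Matrix.mul_sub, Matrix.sub_mul]

omit hU in
/-- The image of a fixed point of the Riccati map is invariant under `A` and contains the image of
`B`. Both inclusions are tested on the matrices `N` that vanish on this image. -/
theorem mul_eq_zero_of_fixedPoint (hD : (D * Dᵀ).PosDef) {Pbar : Matrix (Fin n) (Fin n) ℝ}
    (hP : Pbar.PosSemidef) (hfix : riccati A B C D Pbar = Pbar) {N : Matrix (Fin n) (Fin n) ℝ}
    (hN : N * Pbar = 0) : N * A * Pbar = 0 ∧ N * B = 0 := by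
  have hPt := transpose_of_posSemidef hP
  have hN' : Pbar * Nᵀ = 0 := by
    have := congrArg Matrix.transpose hN
    rwa [Matrix.transpose_mul, hPt, Matrix.transpose_zero] at this
  have key : ∀ w, Pbar *ᵥ (Aᵀ *ᵥ (Nᵀ *ᵥ w)) = 0 ∧ Bᵀ *ᵥ (Nᵀ *ᵥ w) = 0 := by
    intro w
    set x := Nᵀ *ᵥ w with hx
    have hPx : qf Pbar x = 0 := by
      rw [qf, hx, Matrix.mulVec_mulVec, hN', Matrix.zero_mulVec, dotProduct_zero]
    have h1 := qf_riccati A B C hD hP x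
    set K := gain A C D Pbar
    rw [hfix, hPx, qf_add, qf_conj K, qf_mul_transpose B] at h1
    have h2 := qf_nonneg hP ((A - K * C)ᵀ *ᵥ x)
    have h3 := qf_nonneg hD.posSemidef (Kᵀ *ᵥ x)
    have h4 := dot_self_nonneg (Bᵀ *ᵥ x)
    have hK : Kᵀ *ᵥ x = 0 := by
      by_contra hne
      have := (posDef_iff_qf.1 hD).2 _ hne
      linarith
    have hAx : (A - K * C)ᵀ *ᵥ x = Aᵀ *ᵥ x := by
      rw [Matrix.transpose_sub, Matrix.sub_mulVec, Matrix.transpose_mul, ← Matrix.mulVec_mulVec, hK,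
        Matrix.mulVec_zero, sub_zero]
    rw [hAx] at h1 h2
    exact ⟨mulVec_eq_zero_of_qf hP (by linarith), dotProduct_self_eq_zero.1 (by linarith)⟩
  constructor
  · have h1 : Pbar * (Aᵀ * Nᵀ) = 0 := Matrix.ext_of_mulVec_single fun i => by
      rw [← Matrix.mulVec_mulVec, ← Matrix.mulVec_mulVec, (key _).1, Matrix.zero_mulVec]
    have h2 := congrArg Matrix.transpose h1
    rwa [Matrix.transpose_mul, Matrix.transpose_mul, Matrix.transpose_transpose,
      Matrix.transpose_transpose, hPt, Matrix.transpose_zero] at h2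
  · have h1 : Bᵀ * Nᵀ = 0 := Matrix.ext_of_mulVec_single fun i => by
      rw [← Matrix.mulVec_mulVec, (key _).2, Matrix.zero_mulVec]
    have h2 := congrArg Matrix.transpose h1
    rwa [Matrix.transpose_mul, Matrix.transpose_transpose, Matrix.transpose_transpose,
      Matrix.transpose_zero] at h2

theorem proj_mul_eq {m : ℕ} {M : Matrix (Fin n) (Fin m) ℝ}
    (h : ∀ x, M *ᵥ x ∈ LinearMap.range U.mulVecLin) : U * Uᵀ * M = M :=
  Matrix.ext_of_mulVec_single fun i => by
    obtain ⟨y, hy⟩ := h (Pi.single i 1)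
    rw [Matrix.mulVecLin_apply] at hy
    rw [← Matrix.mulVec_mulVec, ← hy, Matrix.mulVec_mulVec, Matrix.mul_assoc, hU, Matrix.mul_one]

end Reduction

end LowRankRiccati

open LowRankRiccati in
theorem corollary2 {n p q : ℕ} (A : Matrix (Fin n) (Fin n) ℝ) (B : Matrix (Fin n) (Fin q) ℝ)
    (C : Matrix (Fin p) (Fin n) ℝ) (D : Matrix (Fin p) (Fin q) ℝ)
    (hD : (D * Dᵀ).PosDef) (hBD : B * Dᵀ = 0)
    (hstab : LowRankRiccati.Stabilizable A B)
    (hobs : LowRankRiccati.ReachableSubsystemObservable A B C) :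
    -- the common limit of the standard Riccati iterations, whose image is spanned by `U` below
    ∃ Pbar : Matrix (Fin n) (Fin n) ℝ,
      (∀ P₀ : Matrix (Fin n) (Fin n) ℝ, P₀.PosSemidef →
        Tendsto (fun t : ℕ => (LowRankRiccati.riccati A B C D)^[t] P₀) atTop (𝓝 Pbar)) ∧
      ∃ cMax : ℝ, 0 < cMax ∧ ∀ c : ℝ, 0 < c → c < cMax →
        ∀ (l : ℕ) (U : Matrix (Fin n) (Fin l) ℝ), Uᵀ * U = 1 →
          LinearMap.range U.mulVecLin = LinearMap.range Pbar.mulVecLin →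
          ∃ PR : Matrix (Fin l) (Fin l) ℝ,
            (PR.PosDef ∧ LowRankRiccati.reducedRobustRiccati A B C D U c PR = PR) ∧
            (∀ X : Matrix (Fin l) (Fin l) ℝ, X.PosDef →
              LowRankRiccati.reducedRobustRiccati A B C D U c X = X → X = PR) ∧
            ∀ P₀ : Matrix (Fin n) (Fin n) ℝ, P₀.PosSemidef →
              Tendsto (fun t : ℕ => (LowRankRiccati.robustRiccati A B C D c)^[t] P₀) atTop
                (𝓝 (U * PR * Uᵀ)) := by
  obtain ⟨Pbar, hP, hfix, hzero, -⟩ := exists_riccati_fixedPoint A B C hD hobs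
  obtain ⟨W, ρ, hWt, hlow, hρ0, hρ1, hW⟩ := exists_closedLoop_lyapunov C hD hstab hP hfix
  refine ⟨Pbar, fun P₀ hP₀ => tendsto_riccati_iterate C hD hP hfix hzero hlow hρ0 hρ1 hW hP₀, ?_⟩
  obtain ⟨cMax, hcMax, hattr⟩ := exists_robust_attractor hD hP hfix hzero hWt hlow hρ0 hρ1 hW
  refine ⟨cMax, hcMax, fun c hc hcm l U hU hrange => ?_⟩
  obtain ⟨Pinf, hPinf, hfixinf, hle, hall⟩ := hattr c hc hcm
  have hPt := transpose_of_posSemidef hP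
  have hPinft := transpose_of_posSemidef hPinf
  -- the columns of `U` span an `A`-invariant subspace that contains the image of `B`
  have hUP : U * Uᵀ * Pbar = Pbar := proj_mul_eq hU fun x => by
    rw [hrange]
    exact ⟨x, rfl⟩
  have hrangeU : ∀ y, ∃ z, Pbar *ᵥ z = U *ᵥ y := fun y => by
    have h : U *ᵥ y ∈ LinearMap.range Pbar.mulVecLin := by
      rw [← hrange]
      exact ⟨y, rfl⟩
    exact h
  obtain ⟨hNA, hNB⟩ := mul_eq_zero_of_fixedPoint (N := 1 - U * Uᵀ) hD hP hfix (by
    rw [Matrix.sub_mul, Matrix.one_mul, hUP, sub_self])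
  have hB : U * (Uᵀ * B) = B := by
    rw [Matrix.sub_mul, Matrix.one_mul, sub_eq_zero, Matrix.mul_assoc] at hNB
    exact hNB.symm
  have hA : U * (Uᵀ * A * U) = A * U := by
    have h : (1 - U * Uᵀ) * A * U = 0 := Matrix.ext_of_mulVec_single fun i => by
      obtain ⟨z, hz⟩ := hrangeU (Pi.single i 1)
      rw [← Matrix.mulVec_mulVec, ← hz, Matrix.mulVec_mulVec, hNA, Matrix.zero_mulVec,
        Matrix.zero_mulVec]
    rw [Matrix.sub_mul, Matrix.sub_mul, Matrix.one_mul, sub_eq_zero] at h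
    rw [h]
    simp only [Matrix.mul_assoc]
  -- orbits starting in this subspace stay there, hence so does the limit
  have hUinf' : U * Uᵀ * Pinf = Pinf := by
    have hmem : ∀ (t : ℕ) x,
        (robustRiccati A B C D c)^[t] 0 *ᵥ x ∈ LinearMap.range U.mulVecLin := by
      intro t
      induction t with
      | zero => intro x; simp
      | succ t ih =>
        rw [Function.iterate_succ_apply', robustRiccati]
        refine riccati_mulVec_mem A B C D ?_ (fun u => ?_) fun x => ?_
        · rintro _ ⟨y, rfl⟩
          refine ⟨(Uᵀ * A * U) *ᵥ y, ?_⟩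
          rw [Matrix.mulVecLin_apply, Matrix.mulVecLin_apply, Matrix.mulVec_mulVec,
            Matrix.mulVec_mulVec, hA]
        · refine ⟨(Uᵀ * B) *ᵥ u, ?_⟩
          rw [Matrix.mulVecLin_apply, Matrix.mulVec_mulVec, hB]
        · have hX := posSemidef_robustRiccati_iterate (A := A) (B := B) (C := C) hD hc
            Matrix.PosSemidef.zero t
          set P := (robustRiccati A B C D c)^[t] 0
          by_cases h0 : P = 0
          · rw [h0, distort_zero, Matrix.zero_mulVec]
            exact Submodule.zero_mem _
          · rw [distort_eq hX (riskParam_spec hX h0 hc).2.1, ← Matrix.mulVec_mulVec]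
            exact ih _
    have hlim := hall 0 Matrix.PosSemidef.zero
    have hcont : Continuous fun X : Matrix (Fin n) (Fin n) ℝ => U * Uᵀ * X := by fun_prop
    exact tendsto_nhds_unique
      (((hcont.tendsto Pinf).comp hlim).congr fun t => proj_mul_eq hU (hmem t)) hlim
  have hUinf : U * (Uᵀ * Pinf * U) * Uᵀ = Pinf := by
    have h1 := congrArg Matrix.transpose hUinf'
    rw [Matrix.transpose_mul, Matrix.transpose_mul, Matrix.transpose_transpose, hPinft] at h1
    calc U * (Uᵀ * Pinf * U) * Uᵀ = (U * Uᵀ * Pinf) * (U * Uᵀ) := by simp only [Matrix.mul_assoc]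
      _ = Pinf := by rw [hUinf', h1]
  have hPR : (Uᵀ * Pinf * U).PosDef := by
    refine posDef_iff_qf.2 ⟨?_, fun y hy => ?_⟩
    · simp only [Matrix.transpose_mul, Matrix.transpose_transpose, hPinft, Matrix.mul_assoc]
    have h1 : qf (Uᵀ * Pinf * U) y = qf Pinf (U *ᵥ y) := by
      have := qf_conj Uᵀ Pinf y
      rwa [Matrix.transpose_transpose] at this
    rw [h1]
    refine lt_of_lt_of_le (lt_of_le_of_ne (qf_nonneg hP _) fun h0 => hy ?_) (hle _)
    have h2 := mulVec_eq_zero_of_qf hP h0.symm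
    obtain ⟨z, hz⟩ := hrangeU y
    have h3 : (U *ᵥ y) ⬝ᵥ (U *ᵥ y) = 0 := by
      nth_rewrite 2 [← hz]
      rw [Matrix.dotProduct_mulVec, ← Matrix.mulVec_transpose, hPt, h2, zero_dotProduct]
    rw [dot_mulVec_isometry hU] at h3
    exact dotProduct_self_eq_zero.1 h3
  refine ⟨Uᵀ * Pinf * U, ⟨hPR, ?_⟩, fun X hX hXfix => ?_, ?_⟩
  · have h1 := robustRiccati_conj (C := C) hU hD hA hB hc hPR
    rw [hUinf, hfixinf] at h1
    have h2 := compress_conj hU (reducedRobustRiccati A B C D U c (Uᵀ * Pinf * U))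
    rw [← h1] at h2
    exact h2.symm
  · have h1 := robustRiccati_conj (C := C) hU hD hA hB hc hX
    rw [hXfix] at h1
    have hX' : (U * X * Uᵀ).PosSemidef := by
      have := hX.posSemidef.mul_mul_conjTranspose_same U
      rwa [Matrix.conjTranspose_eq_transpose_of_trivial] at this
    have h2 : U * X * Uᵀ = Pinf :=
      tendsto_nhds_unique (tendsto_const_nhds.congr fun t => (Function.iterate_fixed h1 t).symm)
        (hall _ hX')
    rw [← h2, compress_conj hU]
  · rw [hUinf]
    exact hall
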